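/- All rings are commutative with $1$. **Definitions.** A *strongly lattice ordered ring* ($f$-ring) is a ring with a binary law $\vee$ which is idempotent, commutative, associative and satisfies $x+(y\vee z)=(x+y)\vee(x+z)$ and $x^+(y\vee z)=(x^+y)\vee(x^+z)$, where $x^+=x\vee 0$. One writes $x\wedge y=-(-x\vee -y)$, $|x|=x\vee -x$, and $x\le y$ for $y\vee x=y$. A *real closed ring structure* on a ring $\mathbf A$ consists of such a law $\vee$ together with operations $\rho_{d,j}:\mathbf A^d\to\mathbf A$ for $1\le j\le d$ (virtual roots) and $\mathrm{Fr}:\mathbf A^2\to\mathbf A$ such that 1. $\mathrm{Fr}(a,b)\,|b|=(|a|\wedge|b|)^2$ and $0\le \mathrm{Fr}(a,b)\le|a|\wedge|b|$ (this makes the integers $d\ge 1$ invertible in $\mathbf A$); 2. for $f=X^d-(a_{d-1}X^{d-1}+\dots+a_0)$, write $\rho_{d,j}(f)=\rho_{d,j}(a_{d-1},\dots,a_0)$. Then $\rho_{1,1}(X-a)=a$; and if $d\ge2$, $g=f'/d$, $x=\rho_{d,j}(f)$, $\sigma=(-1)^{d-j}$, then: - if $j>1$, with $l=\rho_{d-1,j-1}(g)$: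 $\ l\le x$, $\ \sigma(x-l)f(x)\le0$, $\ \sigma(x-l)f(l)\le0$; if $j=1$: $\ \sigma f(x)\le 0$; - if $j<d$, with $r=\rho_{d-1,j}(g)$: $\ x\le r$, $\ \sigma(r-x)f(x)\ge0$, $\ \sigma(r-x)f(r)\ge0$; if $j=d$: $\ f(x)\ge0$; 3. $\rho_{2,2}(a+b,-ab)=a\vee b$. A *real closed ring* is a ring with a real closed ring structure; its morphisms are the ring morphisms which commute with $\vee$, all $\rho_{d,j}$ and $\mathrm{Fr}$. For a quotient map or a localisation map $\mathbf A\to\mathbf B$, the structure *induced* on $\mathbf B$ by a structure on $\mathbf A$ is the one for which this map is a morphism of real closed rings. Monoids $S_1,\dots,S_n$ of $\mathbf A$ are *comaximal* if $s_1,\dots,s_n$ generate the ideal $\langle 1\rangle$ for all $s_1\in S_1,\dots,s_n\in S_n$. **Theorem.** Let $\mathbf A$ be a ring. 1. (Quotient) If $\mathbf A$ is a real closed ring and $I$ is a radical ideal of $\mathbf A$, then $\mathbf A/I$ is a real closed ring: there is exactly one real closed ring structure on $\mathbf A/I$ for which $\mathbf A\to\mathbf A/I$ is a morphism of real closed rings.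 2. (Localisation) If $\mathbf A$ is a real closed ring and $S$ is a monoid of $\mathbf A$, then $S^{-1}\mathbf A$ is a real closed ring: there is exactly one real closed ring structure on $S^{-1}\mathbf A$ for which $\mathbf A\to S^{-1}\mathbf A$ is a morphism of real closed rings. 3. (Gluing) Let $S_1,\dots,S_n$ be comaximal monoids of $\mathbf A$, $\mathbf A_i=S_i^{-1}\mathbf A$ and $\mathbf A_{ij}=(S_iS_j)^{-1}\mathbf A$. Suppose that a real closed ring structure is given on each $\mathbf A_i$, and that for $i<j$ the structures induced on $\mathbf A_{ij}$ by those of $\mathbf A_i$ and $\mathbf A_j$ coincide. Then there is a unique real closed ring structure on $\mathbf A$ which induces the given structure on $\mathbf A_i$ for every $i$. Moreover each $\mathbf A_{ij}$ ($i<j$) carries a unique structure for which the localisation maps $\mathbf A_i\to\mathbf A_{ij}$ and $\mathbf A_j\to\mathbf A_{ij}$ are morphisms of real closed rings, and the real closed ring $\mathbf A$, with the localisation maps $\mathbf A\to\mathbf A_i$, is the projective limit of the diagram formed by the $\mathbf A_i$, the $\mathbf A_{ij}$ ($i<j$) and these maps, in the category of real closed rings. -/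

import Mathlib

open Polynomial

universe u v

/-- The operations of the language of real closed rings that are added to those of a commutative
ring: the binary supremum `sup`, the virtual roots `rho d j` and the fraction `fr`.

A list of coefficients `a : Fin d → A` stands for the monic polynomial
`X ^ d - (a (d-1) X ^ (d-1) + ⋯ + a 1 X + a 0)`; its virtual roots are numbered from `0`, so that
`rho d j a` is the `(j+1)`-st virtual root, `ρ_{d,j+1}(a (d-1), …, a 0)`. -/
@[ext]
structure RealClosedOps (A : Type u) where
  sup : A → A → A
  rho : (d : ℕ) → Fin d → (Fin d → A) → A
  fr : A → A → A

namespace RealClosedOps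

variable {A : Type u} [CommRing A] (s : RealClosedOps A)

/-- `x ∧ y`, that is `-(-x ∨ -y)`. -/
def inf (x y : A) : A := -(s.sup (-x) (-y))

/-- `|x|`, that is `x ∨ -x`. -/
def abs (x : A) : A := s.sup x (-x)

/-- `x⁺`, that is `x ∨ 0`. -/
def pos (x : A) : A := s.sup x 0

/-- `x ≤ y`, that is `y ∨ x = y`. -/
def le (x y : A) : Prop := s.sup y x = y

end RealClosedOps

/-- The monic polynomial `X ^ d - (a (d-1) X ^ (d-1) + ⋯ + a 1 X + a 0)`. -/
noncomputable def monicPoly {A : Type u} [CommRing A] {d : ℕ} (a : Fin d → A) : A[X] :=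
  X ^ d - ∑ i : Fin d, C (a i) * X ^ (i : ℕ)

/-- A real closed ring structure on the commutative ring `A`.

* The first five axioms say that `A` is a strongly lattice ordered ring (an `f`-ring).
* The axioms `rho_*` are the systems of inequalities which define the virtual roots of a monic
  polynomial `f = monicPoly a` of degree `d + 1` from those of its normalised derivative
  `g = f' / (d + 1) = monicPoly b`. (The integer `d + 1` has the inverse `fr 1 (d + 1)` and `A` is
  torsion free, so `b` exists and is unique.) The `j`-th virtual root `x` of `f`
  (`1 ≤ j ≤ d + 1`) is the point where `|f|` is minimal on the interval from `l`, the
  `(j-1)`-st virtual root of `g` (`-∞` if `j = 1`), to `r`, the `j`-th virtual root of `g`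
  (`+∞` if `j = d + 1`). On this interval `σ f` is nondecreasing, where `σ = (-1) ^ (d + 1 - j)`,
  and the system for `x` is
  - `l ≤ x`, `σ (x - l) f(x) ≤ 0`, `σ (x - l) f(l) ≤ 0` if `l` is finite,
  - `x ≤ r`, `σ (r - x) f(x) ≥ 0`, `σ (r - x) f(r) ≥ 0` if `r` is finite,
  - `σ f(x) ≤ 0` if `l = -∞`, and `f(x) ≥ 0` if `r = +∞` (then `σ = 1`).
  With the numbering from `0`, the root number `i.succ` has `l = rho d i b` (and its sign is
  `(-1) ^ (d + 1 + i)`), and the root number `i.castSucc` has `r = rho d i b` (and its sign is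
  `(-1) ^ (d + i)`). -/
@[ext]
structure RealClosedStructure (A : Type u) [CommRing A] extends RealClosedOps A where
  sup_self : ∀ x : A, sup x x = x
  sup_comm : ∀ x y : A, sup x y = sup y x
  sup_assoc : ∀ x y z : A, sup (sup x y) z = sup x (sup y z)
  add_sup : ∀ x y z : A, x + sup y z = sup (x + y) (x + z)
  pos_mul_sup : ∀ x y z : A,
    toRealClosedOps.pos x * sup y z = sup (toRealClosedOps.pos x * y) (toRealClosedOps.pos x * z)
  rho_one : ∀ a : Fin 1 → A, rho 1 0 a = a 0
  rho_lower : ∀ (d : ℕ) (a : Fin (d + 1) → A) (b : Fin d → A),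
    derivative (monicPoly a) = (d + 1) • monicPoly b → ∀ i : Fin d,
      toRealClosedOps.le (rho d i b) (rho (d + 1) i.succ a) ∧
      toRealClosedOps.le ((-1) ^ (d + 1 + (i : ℕ)) * (rho (d + 1) i.succ a - rho d i b) *
        (monicPoly a).eval (rho (d + 1) i.succ a)) 0 ∧
      toRealClosedOps.le ((-1) ^ (d + 1 + (i : ℕ)) * (rho (d + 1) i.succ a - rho d i b) *
        (monicPoly a).eval (rho d i b)) 0
  rho_upper : ∀ (d : ℕ) (a : Fin (d + 1) → A) (b : Fin d → A),
    derivative (monicPoly a) = (d + 1) • monicPoly b → ∀ i : Fin d,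
      toRealClosedOps.le (rho (d + 1) i.castSucc a) (rho d i b) ∧
      toRealClosedOps.le 0 ((-1) ^ (d + (i : ℕ)) * (rho d i b - rho (d + 1) i.castSucc a) *
        (monicPoly a).eval (rho (d + 1) i.castSucc a)) ∧
      toRealClosedOps.le 0 ((-1) ^ (d + (i : ℕ)) * (rho d i b - rho (d + 1) i.castSucc a) *
        (monicPoly a).eval (rho d i b))
  rho_first : ∀ (d : ℕ) (a : Fin (d + 1) → A),
    toRealClosedOps.le ((-1) ^ d * (monicPoly a).eval (rho (d + 1) 0 a)) 0
  rho_last : ∀ (d : ℕ) (a : Fin (d + 1) → A),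
    toRealClosedOps.le 0 ((monicPoly a).eval (rho (d + 1) (Fin.last d) a))
  /-- The larger virtual root of `X ^ 2 - (x + y) X + x y` is `x ∨ y`. -/
  rho_two_eq_sup : ∀ x y : A, rho 2 1 ![-(x * y), x + y] = sup x y
  fr_mul_abs : ∀ x y : A, fr x y * toRealClosedOps.abs y =
    toRealClosedOps.inf (toRealClosedOps.abs x) (toRealClosedOps.abs y) ^ 2
  fr_nonneg : ∀ x y : A, toRealClosedOps.le 0 (fr x y)
  fr_le : ∀ x y : A, toRealClosedOps.le (fr x y)
    (toRealClosedOps.inf (toRealClosedOps.abs x) (toRealClosedOps.abs y))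

/-- The ring morphism `f` is a morphism of real closed rings from `(A, s)` to `(B, t)`: it commutes
with all operations. For a quotient map or a localisation map `f` this says that `t` is the
structure on `B` induced by `s`. -/
structure IsRealClosedHom {A : Type u} {B : Type v} [CommRing A] [CommRing B]
    (s : RealClosedStructure A) (t : RealClosedStructure B) (f : A →+* B) : Prop where
  map_sup : ∀ x y : A, f (s.sup x y) = t.sup (f x) (f y)
  map_rho : ∀ (d : ℕ) (j : Fin d) (a : Fin d → A), f (s.rho d j a) = t.rho d j (fun i => f (a i))
  map_fr : ∀ x y : A, f (s.fr x y) = t.fr (f x) (f y)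

/-- The monoids `S i` are comaximal: elements `x i ∈ S i` always generate the unit ideal. -/
def Comaximal {A : Type u} [CommRing A] {n : ℕ} (S : Fin n → Submonoid A) : Prop :=
  ∀ x : Fin n → A, (∀ i, x i ∈ S i) → Ideal.span (Set.range x) = ⊤

/-- The localisation morphism `S⁻¹A → T⁻¹A` for monoids `S ⊆ T`. -/
noncomputable def localizationMap {A : Type u} [CommRing A] {S T : Submonoid A} (h : S ≤ T) :
    Localization S →+* Localization T :=
  IsLocalization.map (M := S) (T := T) (Localization T) (RingHom.id A) h

-- All three parts reduce to fields. A real closed ring is reduced: if x ^ 2 = 0, then (X - x)(X +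
-- x) and (X - 0)(X - 0) are the same polynomial, so x ∨ -x = 0 ∨ 0 = 0. A reduced ring B embeds in
-- the product of the fields Frac(B/Q), Q prime, and there equations, hence also inequalities, can
-- be checked.
--
-- Let K be a field whose elements are all fractions of images of elements of a real closed ring.
-- Since x⁺ x⁻ = 0 and `fr` makes the kernel convex, K inherits a total order (`exists_order`).
-- Virtual roots map to virtual roots, and rescaling by the square of a denominator provides them
-- for every monic polynomial over K (`exists_isVirtualRoots`). In an ordered field with virtual
-- roots, the intermediate value property and the monotonicity of polynomials with nonnegative
-- derivative follow by a joint induction on the degree (`PolyMono.of_IVT`,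
-- `polyIVT_of_virtualRoots`). Monotonicity makes virtual roots unique, so the order alone
-- determines the structure, and K carries exactly one induced structure (`existsUnique_of_field`).
--
-- Quotients by radical ideals and localisations of a real closed ring are reduced rings B whose
-- elements are fractions of images of elements of A. The operations on the residue fields are
-- homogeneous under multiplication by squares; clearing denominators shows that B is closed under
-- them (`existsUnique_of_isFractionMap`), and the axioms pass to B through the embedding
-- (`exists_of_injective`).
--
-- For gluing, the values of an operation computed in the A_i agree on the A_ij, hence patch to an
-- element of A (`Comaximal.exists_glue`). Patching ring morphisms in the same way gives the limit
-- property.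

universe w

/-! ### Monic polynomials given by their coefficients, and rescaling of their roots -/

section MonicPoly

variable {A : Type u} [CommRing A] {B : Type v} [CommRing B]

theorem monicPoly_coeff_self {d : ℕ} (a : Fin d → A) : (monicPoly a).coeff d = 1 := by
  simp only [monicPoly, coeff_sub, coeff_X_pow, finsetSum_coeff, coeff_C_mul]
  rw [Finset.sum_eq_zero]
  · simp
  · intro i _
    rw [if_neg (by omega), mul_zero]

theorem monicPoly_coeff_lt {d : ℕ} (a : Fin d → A) (i : Fin d) :
    (monicPoly a).coeff (i : ℕ) = -a i := by
  simp only [monicPoly, coeff_sub, coeff_X_pow, finsetSum_coeff, coeff_C_mul]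
  rw [if_neg (by omega), Finset.sum_eq_single i]
  · simp
  · intro j _ hj
    rw [if_neg (fun h => hj (Fin.ext h.symm)), mul_zero]
  · simp

theorem monicPoly_coeff_gt {d n : ℕ} (a : Fin d → A) (h : d < n) :
    (monicPoly a).coeff n = 0 := by
  simp only [monicPoly, coeff_sub, coeff_X_pow, finsetSum_coeff, coeff_C_mul]
  rw [if_neg (by omega), Finset.sum_eq_zero]
  · simp
  · intro i _
    rw [if_neg (by omega), mul_zero]

theorem monicPoly_natDegree_le {d : ℕ} (a : Fin d → A) : (monicPoly a).natDegree ≤ d :=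
  natDegree_le_iff_coeff_eq_zero.2 fun _ h => monicPoly_coeff_gt a h

theorem monicPoly_monic {d : ℕ} (a : Fin d → A) : (monicPoly a).Monic :=
  monic_of_natDegree_le_of_coeff_eq_one d (monicPoly_natDegree_le a) (monicPoly_coeff_self a)

theorem map_monicPoly (f : A →+* B) {d : ℕ} (a : Fin d → A) :
    (monicPoly a).map f = monicPoly fun i => f (a i) := by
  simp [monicPoly, Polynomial.map_sum]

theorem map_eval_monicPoly (f : A →+* B) {d : ℕ} (a : Fin d → A) (x : A) :
    f ((monicPoly a).eval x) = (monicPoly fun i => f (a i)).eval (f x) := by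
  rw [← map_monicPoly, eval_map_apply]

theorem eval_monicPoly {d : ℕ} (a : Fin d → A) (x : A) :
    (monicPoly a).eval x = x ^ d - ∑ i : Fin d, a i * x ^ (i : ℕ) := by
  simp [monicPoly, eval_finsetSum]

theorem eq_monicPoly_of_monic {p : A[X]} (hp : p.Monic) :
    p = monicPoly fun i : Fin p.natDegree => -p.coeff i := by
  ext n
  rcases lt_trichotomy n p.natDegree with h | rfl | h
  · exact ((monicPoly_coeff_lt _ ⟨n, h⟩).trans (neg_neg _)).symm
  · rw [monicPoly_coeff_self, hp.coeff_natDegree]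
  · rw [monicPoly_coeff_gt _ h, coeff_eq_zero_of_natDegree_lt h]

/-- The coefficientwise form is preserved by ring morphisms and by rescaling, which gives
`map_derivative_monicPoly` and `derivative_monicPoly_scaleCoeff`. -/
theorem derivative_monicPoly_iff {d : ℕ} (a : Fin (d + 1) → A) (b : Fin d → A) :
    derivative (monicPoly a) = (d + 1) • monicPoly b ↔
      ∀ i : Fin d, ((i : ℕ) + 1 : A) * a i.succ = (d + 1 : A) * b i := by
  have key (i : Fin d) : (derivative (monicPoly a)).coeff (i : ℕ) =
      -(((i : ℕ) + 1 : A) * a i.succ) := by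
    have := monicPoly_coeff_lt a i.succ
    rw [Fin.val_succ] at this
    rw [coeff_derivative, this]
    ring
  have key' (i : Fin d) : ((d + 1) • monicPoly b).coeff (i : ℕ) = -((d + 1 : A) * b i) := by
    rw [coeff_smul, monicPoly_coeff_lt, nsmul_eq_mul]
    push_cast
    ring
  constructor
  · intro h i
    have := key i
    rw [h, key'] at this
    exact (neg_injective this).symm
  · intro h
    ext n
    rcases lt_trichotomy n d with hn | rfl | hn
    · have h1 := key ⟨n, hn⟩
      have h2 := key' ⟨n, hn⟩
      rw [← h ⟨n, hn⟩] at h2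
      exact h1.trans h2.symm
    · rw [coeff_derivative, coeff_smul, monicPoly_coeff_self, monicPoly_coeff_self]
      simp
    · rw [coeff_derivative, coeff_smul, monicPoly_coeff_gt a (by omega), monicPoly_coeff_gt b hn]
      simp

theorem map_derivative_monicPoly (f : A →+* B) {d : ℕ} {a : Fin (d + 1) → A} {b : Fin d → A}
    (h : derivative (monicPoly a) = (d + 1) • monicPoly b) :
    derivative (monicPoly fun i => f (a i)) = (d + 1) • monicPoly fun i => f (b i) := by
  rw [derivative_monicPoly_iff] at h ⊢
  intro i
  have := congrArg f (h i)
  simpa using this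

/-- The coefficients of the monic polynomial whose roots are `w` times those of `monicPoly a`. -/
def scaleCoeff (w : A) {d : ℕ} (a : Fin d → A) : Fin d → A := fun i => w ^ (d - (i : ℕ)) * a i

theorem eval_monicPoly_scaleCoeff (w : A) {d : ℕ} (a : Fin d → A) (x : A) :
    (monicPoly (scaleCoeff w a)).eval (w * x) = w ^ d * (monicPoly a).eval x := by
  rw [eval_monicPoly, eval_monicPoly, mul_sub, mul_pow, Finset.mul_sum]
  congr 1
  refine Finset.sum_congr rfl fun i _ => ?_
  rw [scaleCoeff, mul_pow]
  calc w ^ (d - (i : ℕ)) * a i * (w ^ (i : ℕ) * x ^ (i : ℕ))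
      = w ^ (d - (i : ℕ)) * w ^ (i : ℕ) * (a i * x ^ (i : ℕ)) := by ring
    _ = _ := by rw [← pow_add, Nat.sub_add_cancel i.2.le]

theorem derivative_monicPoly_scaleCoeff (w : A) {d : ℕ} {a : Fin (d + 1) → A} {b : Fin d → A}
    (h : derivative (monicPoly a) = (d + 1) • monicPoly b) :
    derivative (monicPoly (scaleCoeff w a)) = (d + 1) • monicPoly (scaleCoeff w b) := by
  rw [derivative_monicPoly_iff] at h ⊢
  intro i
  have e : d + 1 - (i.succ : ℕ) = d - (i : ℕ) := by rw [Fin.val_succ]; omega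
  rw [scaleCoeff, scaleCoeff, e]
  linear_combination w ^ (d - (i : ℕ)) * h i

theorem scaleCoeff_scaleCoeff (w z : A) {d : ℕ} (a : Fin d → A) :
    scaleCoeff w (scaleCoeff z a) = scaleCoeff (w * z) a := by
  ext i
  simp [scaleCoeff, mul_pow, mul_assoc]

theorem scaleCoeff_one {d : ℕ} (a : Fin d → A) : scaleCoeff 1 a = a := by
  ext i
  simp [scaleCoeff]

end MonicPoly

/-! ### Virtual roots, intermediate values and monotonicity in an ordered field -/

section OrderedField

variable {K : Type u} [Field K] [LinearOrder K] [IsStrictOrderedRing K]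

theorem derivative_monicPoly_injective {d : ℕ} {a : Fin (d + 1) → K} {b b' : Fin d → K}
    (h : derivative (monicPoly a) = (d + 1) • monicPoly b)
    (h' : derivative (monicPoly a) = (d + 1) • monicPoly b') : b = b' := by
  rw [derivative_monicPoly_iff] at h h'
  ext i
  have : (d + 1 : K) ≠ 0 := by positivity
  exact mul_left_cancel₀ this ((h i).symm.trans (h' i))

/-- `t` lies in the `i`-th of the closed intervals into which `y 0 ≤ y 1 ≤ ⋯` cut the line. -/
def InCell {d : ℕ} (y : Fin d → K) (i : Fin (d + 1)) (t : K) : Prop :=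
  (∀ k : Fin d, k.succ = i → y k ≤ t) ∧ ∀ k : Fin d, k.castSucc = i → t ≤ y k

/-- `x` is the family of virtual roots of `monicPoly a`. -/
def IsVirtualRoots : (d : ℕ) → (Fin d → K) → (Fin d → K) → Prop
  | 0, _, _ => True
  | d + 1, a, x => ∃ b y : Fin d → K, derivative (monicPoly a) = (d + 1) • monicPoly b ∧
      IsVirtualRoots d b y ∧ ∀ i : Fin (d + 1), InCell y i (x i) ∧
        -- In an ordered field the condition σ (x - l) f(x) ≤ 0 says that σ f(x) ≤ 0 as soon as l <
        -- x. When l = -∞ no `k` satisfies `k.succ = i`, the premise is vacuous and the condition is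
        -- unconditional, as `rho_first` requires; likewise for r = +∞ below. The inequalities for
        -- f(l) and f(r) are left out because they follow by monotonicity.
        ((∀ k : Fin d, k.succ = i → y k < x i) →
          (-1) ^ (d + (i : ℕ)) * (monicPoly a).eval (x i) ≤ 0) ∧
        ((∀ k : Fin d, k.castSucc = i → x i < y k) →
          0 ≤ (-1) ^ (d + (i : ℕ)) * (monicPoly a).eval (x i))

theorem IsVirtualRoots.scale {w : K} (hw : 0 ≤ w) : ∀ {d : ℕ} {a x : Fin d → K},
    IsVirtualRoots d a x → IsVirtualRoots d (scaleCoeff w a) fun i => w * x i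
  | 0, _, _, _ => trivial
  | d + 1, a, x, ⟨b, y, hb, hy, h⟩ => by
    refine ⟨scaleCoeff w b, fun i => w * y i, derivative_monicPoly_scaleCoeff w hb, hy.scale hw,
      fun i => ?_⟩
    obtain ⟨⟨h1, h2⟩, h3, h4⟩ := h i
    have e : (-1) ^ (d + (i : ℕ)) * (monicPoly (scaleCoeff w a)).eval (w * x i) =
        w ^ (d + 1) * ((-1) ^ (d + (i : ℕ)) * (monicPoly a).eval (x i)) := by
      rw [eval_monicPoly_scaleCoeff]
      ring
    rw [e]
    refine ⟨⟨fun k hk => mul_le_mul_of_nonneg_left (h1 k hk) hw,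
      fun k hk => mul_le_mul_of_nonneg_left (h2 k hk) hw⟩, fun H => ?_, fun H => ?_⟩
    · exact mul_nonpos_of_nonneg_of_nonpos (by positivity)
        (h3 fun k hk => lt_of_mul_lt_mul_left (H k hk) hw)
    · exact mul_nonneg (by positivity)
        (h4 fun k hk => lt_of_mul_lt_mul_left (H k hk) hw)

/-- Polynomials of degree at most `n` have the intermediate value property. -/
def PolyIVT (K : Type u) [Field K] [LinearOrder K] (n : ℕ) : Prop :=
  ∀ p : K[X], p.natDegree ≤ n → ∀ u v : K, u < v → p.eval u * p.eval v < 0 →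
    ∃ c, u < c ∧ c < v ∧ p.eval c = 0

/-- Polynomials of degree at most `n` with nonnegative derivative are nondecreasing. -/
def PolyMono (K : Type u) [Field K] [LinearOrder K] (n : ℕ) : Prop :=
  ∀ p : K[X], p.natDegree ≤ n → ∀ u v : K, u ≤ v →
    (∀ t, u < t → t < v → 0 ≤ (derivative p).eval t) → p.eval u ≤ p.eval v

theorem Polynomial.eval_nonneg_of_Ioo (p : K[X]) {u v : K} (huv : u < v)
    (h : ∀ t, u < t → t < v → 0 ≤ p.eval t) {t : K} (h1 : u ≤ t) (h2 : t ≤ v) :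
    0 ≤ p.eval t := by
  let _ : TopologicalSpace K := Preorder.topology K
  have : OrderTopology K := ⟨rfl⟩
  have hc : IsClosed {t | 0 ≤ p.eval t} := isClosed_le continuous_const p.continuous
  have hs : Set.Ioo u v ⊆ {t | 0 ≤ p.eval t} := fun t ht => h t ht.1 ht.2
  have := hc.closure_subset_iff.2 hs
  rw [closure_Ioo huv.ne] at this
  exact this ⟨h1, h2⟩

/-- An algebraic substitute for Rolle's theorem: between two consecutive simple roots at which the
derivative is positive, the complementary factor changes sign and so has a further root. This factor
has degree smaller by two, so the intermediate value property in degree `n` suffices. -/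
theorem PolyMono.of_IVT {n : ℕ} (h : PolyIVT K n) : PolyMono K (n + 1) := by
  intro p hp u v huv hd
  by_contra! hlt
  have huv : u < v := lt_of_le_of_ne huv (by rintro rfl; exact lt_irrefl _ hlt)
  have hd' : ∀ t, u ≤ t → t ≤ v → 0 ≤ (derivative p).eval t :=
    fun t => (derivative p).eval_nonneg_of_Ioo huv hd
  -- Minus the slope of the chord: adding the linear term makes `q` vanish at both ends while its
  -- derivative becomes strictly positive.
  set c := (p.eval u - p.eval v) / (v - u) with hc
  have hvu : 0 < v - u := sub_pos.2 huv
  have hc0 : 0 < c := div_pos (sub_pos.2 hlt) hvu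
  set q : K[X] := p - C (p.eval u) + C c * (X - C u) with hq
  have hqu : q.eval u = 0 := by simp [hq]
  have hqv : q.eval v = 0 := by
    simp only [hq, eval_add, eval_sub, eval_C, eval_mul, eval_X, hc]
    field_simp
    ring
  have hdq : ∀ t, u ≤ t → t ≤ v → 0 < (derivative q).eval t := by
    intro t h1 h2
    have : (derivative q).eval t = (derivative p).eval t + c := by simp [hq]
    rw [this]
    linarith [hd' t h1 h2]
  have hq0 : q ≠ 0 := by
    intro h0
    have := hdq u le_rfl huv.le
    simp [h0] at this
  have hqn : q.natDegree ≤ n + 1 := by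
    refine (natDegree_add_le _ _).trans (max_le ((natDegree_sub_le _ _).trans ?_) ?_)
    · simpa using hp
    · exact (natDegree_C_mul_le _ _).trans ((natDegree_X_sub_C_le u).trans (by omega))
  have hne : (q.roots.toFinset.filter fun t => u < t ∧ t ≤ v).Nonempty :=
    ⟨v, by simp [hq0, hqv, huv]⟩
  -- `w` is the first root of `q` after `u`; a root of the complementary factor in between
  -- contradicts this choice.
  set w := Finset.min' _ hne with hw
  have hwm := Finset.min'_mem _ hne
  rw [← hw] at hwm
  simp only [Finset.mem_filter, Multiset.mem_toFinset, mem_roots', IsRoot.def] at hwm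
  obtain ⟨⟨-, hqw⟩, huw, hwv⟩ := hwm
  obtain ⟨q1, hq1⟩ := dvd_iff_isRoot.2 (show q.IsRoot u from hqu)
  have hq1w : q1.IsRoot w := by
    have := hqw
    rw [hq1, eval_mul] at this
    refine (mul_eq_zero.1 this).resolve_left ?_
    simp [sub_eq_zero, huw.ne']
  obtain ⟨h', hh'⟩ := dvd_iff_isRoot.2 hq1w
  have hfac : q = (X - C u) * ((X - C w) * h') := by rw [hq1, hh']
  have h'0 : h' ≠ 0 := by rintro rfl; simp [hfac] at hq0
  have hdeg : h'.natDegree ≤ n := by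
    have : q.natDegree = 1 + (1 + h'.natDegree) := by
      rw [hfac, natDegree_mul (X_sub_C_ne_zero u) (mul_ne_zero (X_sub_C_ne_zero w) h'0),
        natDegree_mul (X_sub_C_ne_zero w) h'0, natDegree_X_sub_C, natDegree_X_sub_C]
    omega
  have e1 : (derivative q).eval u = (u - w) * h'.eval u := by
    rw [hfac]; simp
  have e2 : (derivative q).eval w = (w - u) * h'.eval w := by
    rw [hfac]; simp
  have l1 := hdq u le_rfl huv.le
  have l2 := hdq w huw.le hwv
  rw [e1] at l1
  rw [e2] at l2
  have m1 : h'.eval u < 0 := by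
    by_contra! hh
    nlinarith
  have m2 : 0 < h'.eval w := by
    by_contra! hh
    nlinarith
  obtain ⟨z, hz1, hz2, hz⟩ := h h' hdeg u w huw (mul_neg_of_neg_of_pos m1 m2)
  have : w ≤ z := Finset.min'_le _ _ (by
    simp only [Finset.mem_filter, Multiset.mem_toFinset, mem_roots', IsRoot.def]
    exact ⟨⟨hq0, by rw [hfac]; simp [hz]⟩, hz1, hz2.le.trans hwv⟩)
  exact absurd this (not_le.2 hz2)

omit [IsStrictOrderedRing K] in
theorem PolyMono.mono {m n : ℕ} (h : PolyMono K n) (hmn : m ≤ n) : PolyMono K m :=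
  fun p hp => h p (hp.trans hmn)

/-- If `g` has the expected sign inside the cells of `y`, then `f` is monotone on them. -/
theorem monotone_on_cell {d : ℕ} (hm : PolyMono K (d + 1)) {a : Fin (d + 1) → K} {b y : Fin d → K}
    (hb : derivative (monicPoly a) = (d + 1) • monicPoly b)
    (hs : ∀ (j : Fin (d + 1)) (t : K), (∀ k : Fin d, k.succ = j → y k < t) →
      (∀ k : Fin d, k.castSucc = j → t < y k) → 0 ≤ (-1) ^ (d + (j : ℕ)) * (monicPoly b).eval t)
    {j : Fin (d + 1)} {s t : K} (hst : s ≤ t) (h1 : InCell y j s) (h2 : InCell y j t) :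
    (-1) ^ (d + (j : ℕ)) * (monicPoly a).eval s ≤ (-1) ^ (d + (j : ℕ)) * (monicPoly a).eval t := by
  have := hm (C ((-1) ^ (d + (j : ℕ))) * monicPoly a)
    ((natDegree_C_mul_le _ _).trans (monicPoly_natDegree_le a)) s t hst ?_
  · simpa only [eval_mul, eval_C] using this
  · intro z hz1 hz2
    have := hs j z (fun k hk => (h1.1 k hk).trans_lt hz1) fun k hk => hz2.trans_le (h2.2 k hk)
    rw [derivative_C_mul, hb, eval_mul, eval_C, nsmul_eq_mul, eval_mul, eval_natCast]
    rw [mul_left_comm]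
    exact mul_nonneg (Nat.cast_nonneg _) this

/-- Between consecutive virtual roots the polynomial has constant sign. -/
theorem IsVirtualRoots.sign : ∀ {d : ℕ}, PolyMono K d → ∀ {a x : Fin d → K},
    IsVirtualRoots d a x → ∀ (j : Fin (d + 1)) (t : K), (∀ k : Fin d, k.succ = j → x k < t) →
      (∀ k : Fin d, k.castSucc = j → t < x k) →
      0 ≤ (-1) ^ (d + (j : ℕ)) * (monicPoly a).eval t
  | 0, _, a, _, _, j, t, _, _ => by
    simp [eval_monicPoly]
  | d + 1, hm, a, x, ⟨b, y, hb, hy, h⟩, j, t, h1, h2 => by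
    have hmono := @monotone_on_cell K _ _ _ d hm a b y hb (hy.sign (hm.mono d.le_succ))
    -- Between two consecutive virtual roots of `f` lies one virtual root of the derivative. If `t`
    -- is not beyond it, `t` shares a cell of `y` with the virtual root on its left, otherwise with
    -- the one on its right; monotonicity on that cell carries the sign over.
    by_cases hA : ∃ i : Fin (d + 1), i.succ = j ∧ ∀ k : Fin d, k.castSucc = i → t ≤ y k
    · obtain ⟨i, rfl, hi⟩ := hA
      obtain ⟨hc, -, h4⟩ := h i
      have hxt := h1 i rfl
      have := hmono hxt.le hc ⟨fun k hk => (hc.1 k hk).trans hxt.le, hi⟩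
      have h0 := h4 fun k hk => hxt.trans_le (hi k hk)
      refine (h0.trans this).trans_eq ?_
      rw [Fin.val_succ]
      ring
    · induction j using Fin.lastCases with
      | last =>
        exact absurd ⟨Fin.last d, Fin.succ_last d, fun k hk => absurd hk (Fin.castSucc_ne_last k)⟩ hA
      | cast i =>
        obtain ⟨hc, h3, -⟩ := h i
        have hxt := h2 i rfl
        have hlow : ∀ k : Fin d, k.succ = i → y k ≤ t := by
          rintro k rfl
          by_contra! hlt
          refine hA ⟨k.castSucc, Fin.succ_castSucc k, fun k' hk' => ?_⟩
          rw [Fin.castSucc_injective _ hk']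
          exact hlt.le
        have := hmono hxt.le ⟨hlow, fun k hk => hxt.le.trans (hc.2 k hk)⟩ hc
        have h0 := h3 fun k hk => (hlow k hk).trans_lt hxt
        have h5 := this.trans h0
        rw [Fin.val_castSucc]
        have e : (-1 : K) ^ (d + 1 + (i : ℕ)) * (monicPoly a).eval t =
          -((-1 : K) ^ (d + (i : ℕ)) * (monicPoly a).eval t) := by ring
        rw [e]
        linarith

/-- Suppose two candidates in one cell differ. Then σ f is nondecreasing between them, nonnegative
at the smaller and nonpositive at the larger, hence zero on a whole interval, which is impossible
for a monic polynomial. -/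
theorem IsVirtualRoots.unique : ∀ {d : ℕ}, PolyMono K d → ∀ {a x x' : Fin d → K},
    IsVirtualRoots d a x → IsVirtualRoots d a x' → x = x'
  | 0, _, _, _, _, _, _ => Subsingleton.elim _ _
  | d + 1, hm, a, x, x', ⟨b, y, hb, hy, h⟩, ⟨b', y', hb', hy', h'⟩ => by
    obtain rfl := derivative_monicPoly_injective hb hb'
    obtain rfl := hy.unique (hm.mono d.le_succ) hy'
    have hmono := @monotone_on_cell K _ _ _ d hm a b y hb (hy.sign (hm.mono d.le_succ))
    have key : ∀ z z' : Fin (d + 1) → K,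
        (∀ i : Fin (d + 1), InCell y i (z i) ∧
        ((∀ k : Fin d, k.succ = i → y k < z i) →
          (-1) ^ (d + (i : ℕ)) * (monicPoly a).eval (z i) ≤ 0) ∧
        ((∀ k : Fin d, k.castSucc = i → z i < y k) →
          0 ≤ (-1) ^ (d + (i : ℕ)) * (monicPoly a).eval (z i))) →
        (∀ i : Fin (d + 1), InCell y i (z' i) ∧
        ((∀ k : Fin d, k.succ = i → y k < z' i) →
          (-1) ^ (d + (i : ℕ)) * (monicPoly a).eval (z' i) ≤ 0) ∧
        ((∀ k : Fin d, k.castSucc = i → z' i < y k) →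
          0 ≤ (-1) ^ (d + (i : ℕ)) * (monicPoly a).eval (z' i))) → ∀ i, z' i ≤ z i := by
      intro z z' h h' i
      by_contra! hlt
      obtain ⟨hc, -, h4⟩ := h i
      obtain ⟨hc', h3, -⟩ := h' i
      have l1 := h4 fun k hk => hlt.trans_le (hc'.2 k hk)
      have l2 := h3 fun k hk => (hc.1 k hk).trans_lt hlt
      have hz : ∀ t ∈ Set.Icc (z i) (z' i), (monicPoly a).IsRoot t := by
        intro t ht
        have ct : InCell y i t := ⟨fun k hk => (hc.1 k hk).trans ht.1,
          fun k hk => ht.2.trans (hc'.2 k hk)⟩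
        have e1 := hmono ht.1 hc ct
        have e2 := hmono ht.2 ct hc'
        have e3 : (-1) ^ (d + (i : ℕ)) * (monicPoly a).eval t = 0 := by linarith
        exact (mul_eq_zero.1 e3).resolve_left (pow_ne_zero _ (by norm_num))
      exact (monicPoly_monic a).ne_zero (eq_zero_of_infinite_isRoot _
        ((Set.Icc_infinite hlt).mono hz))
    ext i
    exact le_antisymm (key x' x h' h i) (key x x' h h' i)

/-- The intermediate value property on an interval that contains no virtual root of the
derivative in its interior. -/
theorem exists_root_of_mem_cell {d : ℕ} (hm : PolyMono K (d + 1)) {a x : Fin (d + 1) → K}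
    {b y : Fin d → K}
    (hb : derivative (monicPoly a) = (d + 1) • monicPoly b) (hy : IsVirtualRoots d b y)
    (h : ∀ i : Fin (d + 1), InCell y i (x i) ∧
        ((∀ k : Fin d, k.succ = i → y k < x i) →
          (-1) ^ (d + (i : ℕ)) * (monicPoly a).eval (x i) ≤ 0) ∧
        ((∀ k : Fin d, k.castSucc = i → x i < y k) →
          0 ≤ (-1) ^ (d + (i : ℕ)) * (monicPoly a).eval (x i)))
    {i : Fin (d + 1)} {u v : K} (huv : u < v) (hu : InCell y i u) (hv : InCell y i v)
    (hneg : (monicPoly a).eval u * (monicPoly a).eval v < 0) :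
    ∃ c, u < c ∧ c < v ∧ (monicPoly a).eval c = 0 := by
  have hmono := @monotone_on_cell K _ _ _ d hm a b y hb (hy.sign (hm.mono d.le_succ))
  obtain ⟨hc, h3, h4⟩ := h i
  have e : ((-1 : K) ^ (d + (i : ℕ))) * (-1) ^ (d + (i : ℕ)) = 1 := by
    rw [← mul_pow]; norm_num
  have hneg' : ((-1) ^ (d + (i : ℕ)) * (monicPoly a).eval u) *
      ((-1) ^ (d + (i : ℕ)) * (monicPoly a).eval v) < 0 := by
    calc _ = ((-1 : K) ^ (d + (i : ℕ)) * (-1) ^ (d + (i : ℕ))) *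
          ((monicPoly a).eval u * (monicPoly a).eval v) := by ring
      _ < 0 := by rwa [e, one_mul]
  have huv' := hmono huv.le hu hv
  have l1 : (-1) ^ (d + (i : ℕ)) * (monicPoly a).eval u < 0 := by
    by_contra! hh
    exact absurd hneg' (not_lt.2 (mul_nonneg hh (hh.trans huv')))
  have l2 : 0 < (-1) ^ (d + (i : ℕ)) * (monicPoly a).eval v := by
    by_contra! hh
    exact absurd hneg' (not_lt.2 (mul_nonneg_of_nonpos_of_nonpos l1.le hh))
  have hux : u < x i := by
    by_contra! hh
    have := h4 fun k hk => (hh.trans_lt huv).trans_le (hv.2 k hk)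
    linarith [hmono hh hc hu]
  have hxv : x i < v := by
    by_contra! hh
    have := h3 fun k hk => ((hu.1 k hk).trans_lt huv).trans_le hh
    linarith [hmono hh hv hc]
  -- The root is the virtual root of this cell: being interior, it satisfies both sign conditions.
  refine ⟨x i, hux, hxv, ?_⟩
  have m1 := h3 fun k hk => (hu.1 k hk).trans_lt hux
  have m2 := h4 fun k hk => hxv.trans_le (hv.2 k hk)
  exact (mul_eq_zero.1 (le_antisymm m1 m2)).resolve_left (pow_ne_zero _ (by norm_num))

omit [Field K] [IsStrictOrderedRing K] in
theorem exists_cell {d : ℕ} (y : Fin d → K) {u v : K} (h : ∀ k, ¬ (u < y k ∧ y k < v)) :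
    ∃ i : Fin (d + 1), (∀ k : Fin d, k.succ = i → y k ≤ u) ∧
      ∀ k : Fin d, k.castSucc = i → v ≤ y k := by
  by_cases hv : ∃ k, v ≤ y k
  -- Taking the least such index avoids assuming that `y` is monotone.
  · obtain ⟨k, hk, hmin⟩ := WellFounded.has_min (wellFounded_lt (α := Fin d)) {k | v ≤ y k} hv
    refine ⟨k.castSucc, fun k' hk' => ?_, fun k' hk' => ?_⟩
    · by_contra! hlt
      have hlt' : k' < k := by
        rw [← Fin.castSucc_lt_castSucc_iff, ← hk']
        exact Fin.castSucc_lt_succ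
      exact hmin k' (not_lt.1 fun hh => h k' ⟨hlt, hh⟩) hlt'
    · rw [Fin.castSucc_injective _ hk']
      exact hk
  · push Not at hv
    refine ⟨Fin.last d, fun k _ => not_lt.1 fun hh => h k ⟨hh, hv k⟩, fun k hk =>
      absurd hk (Fin.castSucc_ne_last k)⟩

/-- Induction on the number of virtual roots of the derivative inside the interval: cut at one of
them and keep a half on which the sign changes, until the interval lies in a single cell. -/
theorem exists_root_of_isVirtualRoots {d : ℕ} (hm : PolyMono K (d + 1)) {a x : Fin (d + 1) → K}
    (hx : IsVirtualRoots (d + 1) a x) {u v : K} (huv : u < v)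
    (hneg : (monicPoly a).eval u * (monicPoly a).eval v < 0) :
    ∃ c, u < c ∧ c < v ∧ (monicPoly a).eval c = 0 := by
  obtain ⟨b, y, hb, hy, h⟩ := hx
  induction hn : (Finset.univ.filter fun k => u < y k ∧ y k < v).card using Nat.strong_induction_on
    generalizing u v with
  | _ n ih =>
  by_cases hk : ∃ k, u < y k ∧ y k < v
  · obtain ⟨k, hk1, hk2⟩ := hk
    rcases eq_or_ne ((monicPoly a).eval (y k)) 0 with h0 | h0
    · exact ⟨y k, hk1, hk2, h0⟩
    have hcard (u' v' : K) (h1 : u ≤ u') (h2 : v' ≤ v) (h3 : ¬ (u' < y k ∧ y k < v')) :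
        (Finset.univ.filter fun k => u' < y k ∧ y k < v').card < n := by
      rw [← hn]
      refine Finset.card_lt_card ⟨fun i hi => ?_, fun hsub => h3 ?_⟩
      · simp only [Finset.mem_filter, Finset.mem_univ, true_and] at hi ⊢
        exact ⟨h1.trans_lt hi.1, hi.2.trans_le h2⟩
      · have := @hsub k (by simp [hk1, hk2])
        simpa using this
    by_cases hs : (monicPoly a).eval u * (monicPoly a).eval (y k) < 0
    · obtain ⟨c, c1, c2, c3⟩ := ih _ (hcard u (y k) le_rfl hk2.le (by simp)) hk1 hs rfl
      exact ⟨c, c1, c2.trans hk2, c3⟩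
    · have hs' : (monicPoly a).eval (y k) * (monicPoly a).eval v < 0 := by
        by_contra! hh
        have hpos : 0 < (monicPoly a).eval (y k) ^ 2 := by positivity
        have := mul_nonneg (not_lt.1 hs) hh
        have e : (monicPoly a).eval u * (monicPoly a).eval (y k) *
          ((monicPoly a).eval (y k) * (monicPoly a).eval v) =
          (monicPoly a).eval (y k) ^ 2 * ((monicPoly a).eval u * (monicPoly a).eval v) := by ring
        rw [e] at this
        exact absurd this (not_le.2 (mul_neg_of_pos_of_neg hpos hneg))
      obtain ⟨c, c1, c2, c3⟩ := ih _ (hcard (y k) v hk1.le le_rfl (by simp)) hk2 hs' rfl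
      exact ⟨c, hk1.trans c1, c2, c3⟩
  · push Not at hk
    obtain ⟨i, hi1, hi2⟩ := exists_cell y (u := u) (v := v) fun k hh => absurd hh.2
      (not_lt.2 (hk k hh.1))
    exact exists_root_of_mem_cell hm hb hy h huv
      ⟨hi1, fun k hk => huv.le.trans (hi2 k hk)⟩ ⟨fun k hk => (hi1 k hk).trans huv.le, hi2⟩ hneg

/-- The induction alternates: intermediate values in degree `n` give monotonicity in degree `n + 1`,
which with virtual roots gives intermediate values in degree `n + 1`. -/
theorem polyIVT_of_virtualRoots
    (hK : ∀ (d : ℕ) (a : Fin d → K), ∃ x, IsVirtualRoots d a x) (n : ℕ) : PolyIVT K n := by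
  induction n with
  | zero =>
    intro p hp u v _ hneg
    rw [eq_C_of_natDegree_le_zero hp, eval_C, eval_C] at hneg
    exact absurd hneg (not_lt.2 (mul_self_nonneg _))
  | succ n ih =>
    intro p hp u v huv hneg
    rcases Nat.lt_or_ge p.natDegree (n + 1) with hlt | hge
    · exact ih p (by omega) u v huv hneg
    have hp : p.natDegree = n + 1 := le_antisymm hp hge
    have hp0 : p ≠ 0 := by rintro rfl; simp at hp
    have hl : p.leadingCoeff ≠ 0 := leadingCoeff_ne_zero.2 hp0
    have hmon : (p * C p.leadingCoeff⁻¹).Monic := monic_mul_leadingCoeff_inv hp0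
    have hdeg : (p * C p.leadingCoeff⁻¹).natDegree = n + 1 := by
      rw [natDegree_mul_leadingCoeff_inv p hp0, hp]
    have hq := eq_monicPoly_of_monic hmon
    rw [hdeg] at hq
    obtain ⟨x, hx⟩ := hK (n + 1) fun i => -(p * C p.leadingCoeff⁻¹).coeff i
    have he (t : K) : (p * C p.leadingCoeff⁻¹).eval t = p.eval t * p.leadingCoeff⁻¹ := by simp
    obtain ⟨c, c1, c2, c3⟩ := exists_root_of_isVirtualRoots (PolyMono.of_IVT ih) hx huv (by
      rw [← hq, he, he]
      have : 0 < p.leadingCoeff⁻¹ ^ 2 := by positivity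
      calc _ = p.leadingCoeff⁻¹ ^ 2 * (p.eval u * p.eval v) := by ring
        _ < 0 := mul_neg_of_pos_of_neg this hneg)
    refine ⟨c, c1, c2, ?_⟩
    rw [← hq, he] at c3
    exact (mul_eq_zero.1 c3).resolve_right (inv_ne_zero hl)

theorem polyMono_of_virtualRoots
    (hK : ∀ (d : ℕ) (a : Fin d → K), ∃ x, IsVirtualRoots d a x) (n : ℕ) : PolyMono K n :=
  (PolyMono.of_IVT (polyIVT_of_virtualRoots hK n)).mono n.le_succ

end OrderedField

/-! ### Order, disjoint parts and reducedness of a real closed ring -/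

namespace RealClosedStructure

section LatticeOrderedRing

variable {A : Type u} [CommRing A] (s : RealClosedStructure A)

theorem le_iff_sup {x y : A} : s.le x y ↔ s.sup y x = y := Iff.rfl

theorem le_refl (x : A) : s.le x x := s.sup_self x

theorem le_antisymm {x y : A} (h : s.le x y) (h' : s.le y x) : x = y := by
  rw [le_iff_sup] at h h'
  rw [← h, s.sup_comm, h']

theorem le_trans {x y z : A} (h : s.le x y) (h' : s.le y z) : s.le x z := by
  rw [le_iff_sup] at h h' ⊢
  rw [← h', s.sup_assoc, h]

theorem le_sup_left (x y : A) : s.le x (s.sup x y) := by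
  rw [le_iff_sup, s.sup_comm, ← s.sup_assoc, s.sup_self]

theorem le_sup_right (x y : A) : s.le y (s.sup x y) := by
  rw [s.sup_comm]
  exact s.le_sup_left y x

theorem sup_le {x y z : A} (h : s.le x z) (h' : s.le y z) : s.le (s.sup x y) z := by
  rw [le_iff_sup] at h h' ⊢
  rw [← s.sup_assoc, h, h']

theorem add_le_add_left {x y : A} (h : s.le x y) (z : A) : s.le (z + x) (z + y) := by
  rw [le_iff_sup] at h ⊢
  rw [← s.add_sup, h]

theorem sub_nonneg {x y : A} : s.le 0 (y - x) ↔ s.le x y := by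
  constructor
  · intro h
    simpa using s.add_le_add_left h x
  · intro h
    simpa [sub_eq_neg_add] using s.add_le_add_left h (-x)

theorem add_nonneg {x y : A} (hx : s.le 0 x) (hy : s.le 0 y) : s.le 0 (x + y) :=
  s.le_trans hx (by simpa using s.add_le_add_left hy x)

theorem pos_of_nonneg {x : A} (h : s.le 0 x) : s.pos x = x := h

theorem pos_nonneg (x : A) : s.le 0 (s.pos x) := s.le_sup_right x 0

theorem mul_nonneg {x y : A} (hx : s.le 0 x) (hy : s.le 0 y) : s.le 0 (x * y) := by
  have := s.pos_mul_sup x y 0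
  rw [s.pos_of_nonneg hx, mul_zero, s.le_iff_sup.1 hy] at this
  exact this.symm

theorem sup_eq_add_pos (x y : A) : s.sup x y = x + s.pos (y - x) := by
  rw [RealClosedOps.pos, s.add_sup, s.sup_comm]
  simp

theorem pos_sub_pos_neg (x : A) : s.pos x - s.pos (-x) = x := by
  have : s.pos x = x + s.pos (-x) := by
    rw [RealClosedOps.pos, s.sup_eq_add_pos, zero_sub]
  rw [this]
  ring

theorem sup_neg_pos (x : A) : s.sup (-s.pos x) (-s.pos (-x)) = 0 := by
  have h : -s.pos x = -s.pos (-x) + -x := by linear_combination -(s.pos_sub_pos_neg x)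
  have h2 : s.sup (-x) 0 = s.pos (-x) := rfl
  calc s.sup (-s.pos x) (-s.pos (-x)) = s.sup (-s.pos (-x) + -x) (-s.pos (-x) + 0) := by
        rw [h, add_zero]
    _ = -s.pos (-x) + s.pos (-x) := by rw [← s.add_sup, h2]
    _ = 0 := by ring

/-- Elements `p`, `m` with `p ∧ m = 0` have the product zero. -/
theorem mul_eq_zero_of_sup_neg {p m : A} (h : s.sup (-p) (-m) = 0) : p * m = 0 := by
  have hp : s.le 0 p := by
    have := s.le_sup_left (-p) (-m)
    rw [h] at this
    simpa using s.add_le_add_left this p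
  have hm : s.le 0 m := by
    have := s.le_sup_right (-p) (-m)
    rw [h] at this
    simpa using s.add_le_add_left this m
  -- Multiplying -p ∨ -m = 0 by (e + p)(e + m) ≥ 0 gives a supremum 0 of two terms, each at most
  -- -epm. Here 0 ≤ 1 is not yet available, so `e = 1` is replaced by the two parts 1⁺ and 1⁻, whose
  -- difference is 1.
  have key : ∀ e : A, s.le 0 e → e * (p * m) = 0 := by
    intro e he
    have h1 := s.pos_mul_sup ((e + p) * (e + m)) (-p) (-m)
    rw [s.pos_of_nonneg (s.mul_nonneg (s.add_nonneg he hp) (s.add_nonneg he hm)), h,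
      mul_zero] at h1
    have hz := s.mul_nonneg he (s.mul_nonneg hp hm)
    refine s.le_antisymm ?_ hz
    have l1 : s.le ((e + p) * (e + m) * -p) (-(e * (p * m))) := by
      rw [← s.sub_nonneg]
      have : s.le 0 (e * e * p + e * p * p + p * p * m) :=
        s.add_nonneg (s.add_nonneg (s.mul_nonneg (s.mul_nonneg he he) hp)
          (s.mul_nonneg (s.mul_nonneg he hp) hp)) (s.mul_nonneg (s.mul_nonneg hp hp) hm)
      convert this using 1
      ring
    have l2 : s.le ((e + p) * (e + m) * -m) (-(e * (p * m))) := by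
      rw [← s.sub_nonneg]
      have : s.le 0 (e * e * m + e * m * m + p * m * m) :=
        s.add_nonneg (s.add_nonneg (s.mul_nonneg (s.mul_nonneg he he) hm)
          (s.mul_nonneg (s.mul_nonneg he hm) hm)) (s.mul_nonneg (s.mul_nonneg hp hm) hm)
      convert this using 1
      ring
    have l3 := s.sup_le l1 l2
    rw [← h1] at l3
    simpa using s.add_le_add_left l3 (e * (p * m))
  have e1 := key _ (s.pos_nonneg 1)
  have e2 := key _ (s.pos_nonneg (-1))
  linear_combination e1 - e2 - (p * m) * s.pos_sub_pos_neg 1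

theorem pos_mul_pos_neg (x : A) : s.pos x * s.pos (-x) = 0 :=
  s.mul_eq_zero_of_sup_neg (s.sup_neg_pos x)

theorem sq_nonneg (x : A) : s.le 0 (x ^ 2) := by
  have h := s.add_nonneg (s.mul_nonneg (s.pos_nonneg x) (s.pos_nonneg x))
    (s.mul_nonneg (s.pos_nonneg (-x)) (s.pos_nonneg (-x)))
  have e : x ^ 2 = s.pos x * s.pos x + s.pos (-x) * s.pos (-x) := by
    have h1 := s.pos_mul_pos_neg x
    have h2 := s.pos_sub_pos_neg x
    linear_combination (-x - s.pos x + s.pos (-x)) * h2 - 2 * h1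
  rwa [e]

theorem abs_of_nonneg {x : A} (h : s.le 0 x) : s.abs x = x := by
  have : s.le (-x) 0 := by simpa using s.add_le_add_left h (-x)
  exact s.le_trans this h

theorem inf_of_le {x y : A} (h : s.le x y) : s.inf x y = x := by
  have : s.le (-y) (-x) := by
    have := s.add_le_add_left h (-x - y)
    rwa [sub_add_cancel, show -x - y + x = -y by ring] at this
  rw [RealClosedOps.inf, s.le_iff_sup.1 this, neg_neg]

/-- If `0 ≤ x ≤ y` then `y` divides `x ^ 2`. -/
theorem fr_mul_of_le {x y : A} (h0 : s.le 0 x) (h : s.le x y) : s.fr x y * y = x ^ 2 := by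
  have := s.fr_mul_abs x y
  rwa [s.abs_of_nonneg h0, s.abs_of_nonneg (s.le_trans h0 h), s.inf_of_le h] at this

/-- The coefficients of (X - x)(X + x) are those of X ^ 2, so `rho_two_eq_sup` identifies x ∨ -x
with 0 ∨ 0, whence x ≤ 0 and -x ≤ 0. -/
theorem eq_zero_of_sq_eq_zero (s : RealClosedStructure A) {x : A} (h : x ^ 2 = 0) : x = 0 := by
  have h1 := s.rho_two_eq_sup x (-x)
  have h2 := s.rho_two_eq_sup 0 0
  have e : ![-(x * -x), x + -x] = ![-((0 : A) * 0), 0 + 0] := by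
    have : -(x * -x) = x ^ 2 := by ring
    rw [this, h]
    simp
  rw [e, h2, s.sup_self] at h1
  have l1 := s.le_sup_left x (-x)
  have l2 := s.le_sup_right x (-x)
  rw [← h1] at l1 l2
  refine s.le_antisymm l1 ?_
  simpa using s.add_le_add_left l2 x

theorem isReduced (s : RealClosedStructure A) : IsReduced A :=
  isReduced_iff_pow_one_lt 2 one_lt_two |>.2 fun _ h => s.eq_zero_of_sq_eq_zero h

end LatticeOrderedRing

/-! ### The order on a field of fractions of an image of a real closed ring -/

section Field

/-- Every element of `B` is a fraction of elements of the image of `f`. -/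
def IsFractionMap {A : Type u} [CommRing A] {B : Type v} [CommRing B] (f : A →+* B) : Prop :=
  ∀ b : B, ∃ a v, IsUnit (f v) ∧ f v * b = f a

variable {A : Type u} [CommRing A] (s : RealClosedStructure A) {K : Type v} [Field K] (φ : A →+* K)

/-- Convexity of the kernel: x ^ 2 is a multiple of y, by `fr`. This is what makes the image cone
pointed. -/
theorem map_eq_zero_of_le {x y : A} (h0 : s.le 0 x) (h : s.le x y) (hy : φ y = 0) : φ x = 0 := by
  have := congrArg φ (s.fr_mul_of_le h0 h)
  rw [map_mul, hy, mul_zero, map_pow] at this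
  exact pow_eq_zero_iff two_ne_zero |>.1 this.symm

theorem map_pos_eq_zero_or (x : A) : φ (s.pos x) = 0 ∨ φ (s.pos (-x)) = 0 := by
  rw [← mul_eq_zero, ← map_mul, s.pos_mul_pos_neg, map_zero]

/-- The cone of nonnegative elements of a field of fractions of an image of `A`. -/
def fieldCone : RingCone K where
  carrier := {k | ∃ a w, s.le 0 a ∧ φ w ≠ 0 ∧ k * φ w ^ 2 = φ a}
  mul_mem' := by
    rintro k l ⟨a, w, ha, hw, h⟩ ⟨b, z, hb, hz, h'⟩
    refine ⟨a * b, w * z, s.mul_nonneg ha hb, by simp [hw, hz], ?_⟩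
    rw [map_mul, map_mul, ← h, ← h']
    ring
  one_mem' := ⟨1, 1, by simpa using s.sq_nonneg 1, by simp, by simp⟩
  add_mem' := by
    rintro k l ⟨a, w, ha, hw, h⟩ ⟨b, z, hb, hz, h'⟩
    refine ⟨a * z ^ 2 + b * w ^ 2, w * z, s.add_nonneg (s.mul_nonneg ha (s.sq_nonneg z))
      (s.mul_nonneg hb (s.sq_nonneg w)), by simp [hw, hz], ?_⟩
    simp only [map_add, map_mul, map_pow, ← h, ← h']
    ring
  zero_mem' := ⟨0, 1, s.le_refl 0, by simp, by simp⟩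
  eq_zero_of_mem_of_neg_mem' := by
    rintro k ⟨a, w, ha, hw, h⟩ ⟨b, z, hb, hz, h'⟩
    have h0 : φ (a * z ^ 2 + b * w ^ 2) = 0 := by
      simp only [map_add, map_mul, map_pow, ← h, ← h']
      ring
    have h1 := s.map_eq_zero_of_le φ (s.mul_nonneg ha (s.sq_nonneg z)) (s.sub_nonneg.1 (by
      rw [add_sub_cancel_left]
      exact s.mul_nonneg hb (s.sq_nonneg w))) h0
    rw [map_mul, ← h, map_pow] at h1
    simpa [hw, hz] using h1

variable {φ}

theorem exists_order (hφ : IsFractionMap φ) : ∃ _ : LinearOrder K, IsStrictOrderedRing K ∧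
    ∀ x y, φ (s.sup x y) = max (φ x) (φ y) := by
  classical
  have htot : HasMemOrNegMem (s.fieldCone φ) := ⟨fun k => by
    obtain ⟨a, w, hw, h⟩ := hφ k
    replace hw := hw.ne_zero
    -- As `k` = a/w, also k w² = aw, and one of the two parts of aw vanishes in `K`: the cone is
    -- total.
    rcases s.map_pos_eq_zero_or φ (a * w) with h0 | h0
    · refine Or.inr ⟨s.pos (-(a * w)), w, s.pos_nonneg _, hw, ?_⟩
      have := congrArg φ (s.pos_sub_pos_neg (a * w))
      rw [map_sub, h0, map_mul, ← h] at this
      linear_combination this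
    · refine Or.inl ⟨s.pos (a * w), w, s.pos_nonneg _, hw, ?_⟩
      have := congrArg φ (s.pos_sub_pos_neg (a * w))
      rw [map_sub, h0, map_mul, ← h] at this
      linear_combination -this⟩
  let lo : LinearOrder K := LinearOrder.mkOfAddGroupCone (s.fieldCone φ)
  have hor : IsOrderedRing K := IsOrderedRing.mkOfCone (s.fieldCone φ)
  have hle : ∀ x y, s.le x y → φ x ≤ φ y := fun x y h =>
    show φ y - φ x ∈ s.fieldCone φ from ⟨y - x, 1, s.sub_nonneg.2 h, by simp, by simp⟩
  refine ⟨lo, IsOrderedRing.toIsStrictOrderedRing K, fun x y => ?_⟩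
  refine _root_.le_antisymm ?_ (max_le (hle _ _ (s.le_sup_left x y)) (hle _ _ (s.le_sup_right x y)))
  rcases s.map_pos_eq_zero_or φ (y - x) with h0 | h0
  · rw [s.sup_eq_add_pos, map_add, h0, add_zero]
    exact le_max_left _ _
  · rw [s.sup_comm, s.sup_eq_add_pos, map_add, ← neg_sub y x, h0, add_zero]
    exact le_max_right _ _

end Field

end RealClosedStructure

/-! ### Division by integers and clearing of denominators -/

namespace RealClosedStructure

section Derivative

variable {A : Type u} [CommRing A]

/-- Since 0 ≤ 1 ≤ n + 1, `fr` shows that n + 1 divides 1 ^ 2. -/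
theorem exists_natCast_inverse (s : RealClosedStructure A) (n : ℕ) :
    ∃ c : A, (n + 1 : A) * c = 1 := by
  have h1 : s.le 0 (1 : A) := by simpa using s.sq_nonneg 1
  have hn : ∀ n : ℕ, s.le 0 (n : A) := by
    intro n
    induction n with
    | zero => simpa using s.le_refl 0
    | succ n ih =>
      rw [Nat.cast_succ]
      exact s.add_nonneg ih h1
  have h := s.fr_mul_of_le h1 (y := (n + 1 : A)) (s.sub_nonneg.1 (by simpa using hn n))
  exact ⟨s.fr 1 (n + 1), by rw [mul_comm, h, one_pow]⟩

theorem exists_normalized_derivative (s : RealClosedStructure A) {d : ℕ} (a : Fin (d + 1) → A) :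
    ∃ b : Fin d → A, derivative (monicPoly a) = (d + 1) • monicPoly b := by
  obtain ⟨c, hc⟩ := s.exists_natCast_inverse d
  refine ⟨fun i => c * (((i : ℕ) + 1 : A) * a i.succ), ?_⟩
  rw [derivative_monicPoly_iff]
  intro i
  rw [← mul_assoc (d + 1 : A), hc, one_mul]

end Derivative

section FractionMap

variable {A : Type u} [CommRing A] {B : Type v} [CommRing B] {f : A →+* B}

theorem IsFractionMap.exists_family (hf : IsFractionMap f) {n : ℕ} (b : Fin n → B) :
    ∃ (a : Fin n → A) (v : A), IsUnit (f v) ∧ ∀ i, f v * b i = f (a i) := by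
  choose a v hv h using fun i => hf (b i)
  refine ⟨fun i => (∏ j ∈ Finset.univ.erase i, v j) * a i, ∏ j, v j, ?_, fun i => ?_⟩
  · rw [map_prod]
    exact Finset.prod_induction _ IsUnit (fun _ _ => IsUnit.mul) isUnit_one fun j _ => hv j
  · rw [← Finset.prod_erase_mul _ _ (Finset.mem_univ i), map_mul, map_mul, mul_assoc, h]

/-- The common denominator is taken to be a square because squares are nonnegative, and
multiplication by them commutes with the supremum. -/
theorem IsFractionMap.exists_pair (hf : IsFractionMap f) (x y : B) :
    ∃ a b v : A, IsUnit (f v) ∧ f v ^ 2 * x = f a ∧ f v ^ 2 * y = f b := by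
  obtain ⟨a, v, hv, h⟩ := hf x
  obtain ⟨b, w, hw, h'⟩ := hf y
  refine ⟨v * w ^ 2 * a, v ^ 2 * w * b, v * w, by simpa using ⟨hv, hw⟩, ?_, ?_⟩
  · simp only [map_mul, map_pow, ← h]
    ring
  · simp only [map_mul, map_pow, ← h']
    ring

theorem IsFractionMap.exists_scaleCoeff (hf : IsFractionMap f) {d : ℕ} (b : Fin d → B) :
    ∃ (a : Fin d → A) (v : A), IsUnit (f v) ∧ scaleCoeff (f v ^ 2) b = fun i => f (a i) := by
  obtain ⟨a, v, hv, h⟩ := hf.exists_family b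
  -- One factor `v` is spent on turning `b i` into `a i`; since `i < d` the exponent is not
  -- truncated.
  refine ⟨fun i => v ^ (2 * (d - (i : ℕ)) - 1) * a i, v, hv, funext fun i => ?_⟩
  have e : 2 * (d - (i : ℕ)) = 2 * (d - (i : ℕ)) - 1 + 1 := by omega
  rw [scaleCoeff, map_mul, ← h, ← pow_mul, e, pow_succ, map_pow]
  simp only [Nat.add_sub_cancel]
  ring

theorem sq_mul_sup (t : RealClosedStructure B) (w x y : B) :
    w ^ 2 * t.sup x y = t.sup (w ^ 2 * x) (w ^ 2 * y) := by
  have := t.pos_mul_sup (w ^ 2) x y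
  rwa [t.pos_of_nonneg (t.sq_nonneg w)] at this

theorem sup_unique {s : RealClosedStructure A} (hf : IsFractionMap f)
    {t t' : RealClosedStructure B} (h : IsRealClosedHom s t f) (h' : IsRealClosedHom s t' f)
    (x y : B) : t.sup x y = t'.sup x y := by
  obtain ⟨a, b, v, hv, ha, hb⟩ := hf.exists_pair x y
  refine (hv.pow 2).mul_left_cancel ?_
  rw [sq_mul_sup, sq_mul_sup, ha, hb, ← h.map_sup, ← h'.map_sup]

end FractionMap

/-! ### The structure determined by the order of a field -/

section OrderedField

variable {A : Type u} [CommRing A] (s : RealClosedStructure A) {K : Type v} [Field K]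
  [LinearOrder K] [IsStrictOrderedRing K] {φ : A →+* K}

omit [IsStrictOrderedRing K] in
theorem map_le (hsup : ∀ x y, φ (s.sup x y) = max (φ x) (φ y)) {x y : A} (h : s.le x y) :
    φ x ≤ φ y := by
  have := congrArg φ (s.le_iff_sup.1 h)
  rw [hsup] at this
  exact max_eq_left_iff.1 this

omit [IsStrictOrderedRing K] in
theorem map_abs (hsup : ∀ x y, φ (s.sup x y) = max (φ x) (φ y)) (x : A) :
    φ (s.abs x) = |φ x| := by
  rw [RealClosedOps.abs, hsup, map_neg]
  rfl

theorem map_inf (hsup : ∀ x y, φ (s.sup x y) = max (φ x) (φ y)) (x y : A) :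
    φ (s.inf x y) = min (φ x) (φ y) := by
  rw [RealClosedOps.inf, map_neg, hsup, map_neg, map_neg, max_neg_neg, neg_neg]

theorem isVirtualRoots_map (hsup : ∀ x y, φ (s.sup x y) = max (φ x) (φ y)) : ∀ {d : ℕ}
    (a : Fin d → A), IsVirtualRoots d (fun i => φ (a i)) fun j => φ (s.rho d j a)
  | 0, _ => trivial
  | d + 1, a => by
    obtain ⟨b, hb⟩ := s.exists_normalized_derivative a
    refine ⟨fun i => φ (b i), fun j => φ (s.rho d j b), map_derivative_monicPoly φ hb,
      isVirtualRoots_map hsup b, fun i => ⟨⟨?_, ?_⟩, ?_, ?_⟩⟩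
    · rintro k rfl
      exact s.map_le hsup (s.rho_lower d a b hb k).1
    · rintro k rfl
      exact s.map_le hsup (s.rho_upper d a b hb k).1
    · intro h
      induction i using Fin.cases with
      | zero =>
        have := s.map_le hsup (s.rho_first d a)
        simpa [map_eval_monicPoly] using this
      | succ k =>
        have h1 := sub_pos.2 (h k rfl)
        have h2 := s.map_le hsup (s.rho_lower d a b hb k).2.1
        simp only [map_mul, map_pow, map_neg, map_one, map_sub, map_zero,
          map_eval_monicPoly] at h2
        by_contra! hlt
        refine absurd h2 (not_le.2 (lt_of_lt_of_eq (mul_pos h1 hlt) ?_))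
        rw [Fin.val_succ]
        ring
    · intro h
      induction i using Fin.lastCases with
      | last =>
        have := s.map_le hsup (s.rho_last d a)
        simpa [map_eval_monicPoly, ← two_mul] using this
      | cast k =>
        have h1 := sub_pos.2 (h k rfl)
        have h2 := s.map_le hsup (s.rho_upper d a b hb k).2.1
        simp only [map_mul, map_pow, map_neg, map_one, map_sub, map_zero,
          map_eval_monicPoly] at h2
        by_contra! hlt
        refine absurd h2 (not_le.2 (lt_of_eq_of_lt ?_ (mul_neg_of_pos_of_neg h1 hlt)))
        rw [Fin.val_castSucc]
        ring

/-- Rescaling the roots by the square of a denominator brings the coefficients into the image of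
`A`; the virtual roots found there are scaled back. -/
theorem exists_isVirtualRoots (hφ : IsFractionMap φ)
    (hsup : ∀ x y, φ (s.sup x y) = max (φ x) (φ y)) (d : ℕ) (b : Fin d → K) :
    ∃ x, IsVirtualRoots d b x := by
  obtain ⟨a, v, hv, h⟩ := hφ.exists_scaleCoeff b
  have hx := s.isVirtualRoots_map hsup a
  rw [← h] at hx
  have hv0 : φ v ^ 2 ≠ 0 := pow_ne_zero _ hv.ne_zero
  have := hx.scale (w := (φ v ^ 2)⁻¹) (by positivity)
  rw [scaleCoeff_scaleCoeff, inv_mul_cancel₀ hv0, scaleCoeff_one] at this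
  exact ⟨_, this⟩

/-- The operations on an ordered field in which virtual roots exist. -/
noncomputable def orderedFieldOps (hK : ∀ (d : ℕ) (a : Fin d → K), ∃ x, IsVirtualRoots d a x) :
    RealClosedOps K where
  sup := max
  rho d j a := (hK d a).choose j
  -- For `y = 0` the quotient is 0, the only value allowed by the bounds on `fr`.
  fr x y := min |x| |y| ^ 2 / |y|

omit [IsStrictOrderedRing K] in
theorem orderedFieldOps_le {hK : ∀ (d : ℕ) (a : Fin d → K), ∃ x, IsVirtualRoots d a x} {x y : K} :
    (orderedFieldOps hK).le x y ↔ x ≤ y := max_eq_left_iff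

omit [IsStrictOrderedRing K] in
theorem orderedFieldOps_abs {hK : ∀ (d : ℕ) (a : Fin d → K), ∃ x, IsVirtualRoots d a x} (x : K) :
    (orderedFieldOps hK).abs x = |x| := rfl

theorem orderedFieldOps_inf {hK : ∀ (d : ℕ) (a : Fin d → K), ∃ x, IsVirtualRoots d a x} (x y : K) :
    (orderedFieldOps hK).inf x y = min x y := by
  change -max (-x) (-y) = _
  rw [max_neg_neg, neg_neg]

omit [IsStrictOrderedRing K] in
theorem isVirtualRoots_orderedFieldOps
    (hK : ∀ (d : ℕ) (a : Fin d → K), ∃ x, IsVirtualRoots d a x) {d : ℕ} (a : Fin d → K) :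
    IsVirtualRoots d a fun j => (orderedFieldOps hK).rho d j a := (hK d a).choose_spec

theorem orderedFieldOps_rho (hK : ∀ (d : ℕ) (a : Fin d → K), ∃ x, IsVirtualRoots d a x) {d : ℕ}
    {a x : Fin d → K} (hx : IsVirtualRoots d a x) (j : Fin d) :
    (orderedFieldOps hK).rho d j a = x j :=
  congrFun ((isVirtualRoots_orderedFieldOps hK a).unique (polyMono_of_virtualRoots hK d) hx) j

/-- The virtual roots are chosen separately in each degree; uniqueness makes the choices for a
polynomial and for its derivative compatible. -/
theorem orderedFieldOps_rho_succ (hK : ∀ (d : ℕ) (a : Fin d → K), ∃ x, IsVirtualRoots d a x)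
    {d : ℕ} {a : Fin (d + 1) → K} {b : Fin d → K}
    (hb : derivative (monicPoly a) = (d + 1) • monicPoly b) (i : Fin (d + 1)) :
    InCell (fun k => (orderedFieldOps hK).rho d k b) i ((orderedFieldOps hK).rho (d + 1) i a) ∧
      ((∀ k : Fin d, k.succ = i →
          (orderedFieldOps hK).rho d k b < (orderedFieldOps hK).rho (d + 1) i a) →
        (-1) ^ (d + (i : ℕ)) * (monicPoly a).eval ((orderedFieldOps hK).rho (d + 1) i a) ≤ 0) ∧
      ((∀ k : Fin d, k.castSucc = i →
          (orderedFieldOps hK).rho (d + 1) i a < (orderedFieldOps hK).rho d k b) →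
        0 ≤ (-1) ^ (d + (i : ℕ)) * (monicPoly a).eval ((orderedFieldOps hK).rho (d + 1) i a)) := by
  obtain ⟨b', y, hb', hy, h⟩ := isVirtualRoots_orderedFieldOps hK a
  obtain rfl := derivative_monicPoly_injective hb hb'
  obtain rfl : (fun k => (orderedFieldOps hK).rho d k b) = y :=
    funext fun k => orderedFieldOps_rho hK hy k
  exact h i

theorem orderedFieldOps_monotone (hK : ∀ (d : ℕ) (a : Fin d → K), ∃ x, IsVirtualRoots d a x)
    {d : ℕ} {a : Fin (d + 1) → K} {b : Fin d → K}
    (hb : derivative (monicPoly a) = (d + 1) • monicPoly b) {i : Fin (d + 1)} {x y : K}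
    (hxy : x ≤ y) (hx : InCell (fun k => (orderedFieldOps hK).rho d k b) i x)
    (hy : InCell (fun k => (orderedFieldOps hK).rho d k b) i y) :
    (-1) ^ (d + (i : ℕ)) * (monicPoly a).eval x ≤ (-1) ^ (d + (i : ℕ)) * (monicPoly a).eval y :=
  monotone_on_cell (polyMono_of_virtualRoots hK (d + 1)) hb
    ((isVirtualRoots_orderedFieldOps hK b).sign (polyMono_of_virtualRoots hK d)) hxy hx hy

/-- The real closed ring structure of an ordered field in which virtual roots exist. -/
noncomputable def ofOrderedField (hK : ∀ (d : ℕ) (a : Fin d → K), ∃ x, IsVirtualRoots d a x) :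
    RealClosedStructure K where
  __ := orderedFieldOps hK
  sup_self := max_self
  sup_comm := max_comm
  sup_assoc := max_assoc
  add_sup x y z := (max_add_add_left x y z).symm
  pos_mul_sup x y z := mul_max_of_nonneg _ _ (le_max_right x 0)
  rho_one a := by
    obtain ⟨b, hb⟩ : ∃ b : Fin 0 → K, derivative (monicPoly a) = (0 + 1) • monicPoly b :=
      ⟨Fin.elim0, (derivative_monicPoly_iff _ _).2 fun i => i.elim0⟩
    obtain ⟨-, h1, h2⟩ := orderedFieldOps_rho_succ hK hb 0
    have := _root_.le_antisymm (h1 fun k => k.elim0) (h2 fun k => k.elim0)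
    simpa [eval_monicPoly, sub_eq_zero] using this
  rho_lower d a b hb i := by
    simp only [orderedFieldOps_le]
    obtain ⟨hc, h1, -⟩ := orderedFieldOps_rho_succ hK hb i.succ
    have hle := hc.1 i rfl
    rcases hle.eq_or_lt with he | hlt
    · simp [he]
    have h2 := h1 fun k hk => by rwa [Fin.succ_injective _ hk]
    have hm := orderedFieldOps_monotone hK hb hle
      ⟨fun k hk => by rw [Fin.succ_injective _ hk], fun k hk => hle.trans (hc.2 k hk)⟩ hc
    have e : d + ((i.succ : Fin (d + 1)) : ℕ) = d + 1 + (i : ℕ) := by rw [Fin.val_succ]; omega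
    rw [e] at h2 hm
    refine ⟨hle, ?_, ?_⟩
    · rw [mul_assoc, mul_left_comm]
      exact mul_nonpos_of_nonneg_of_nonpos (_root_.sub_nonneg.2 hle) h2
    · rw [mul_assoc, mul_left_comm]
      exact mul_nonpos_of_nonneg_of_nonpos (_root_.sub_nonneg.2 hle) (hm.trans h2)
  rho_upper d a b hb i := by
    simp only [orderedFieldOps_le]
    obtain ⟨hc, -, h1⟩ := orderedFieldOps_rho_succ hK hb i.castSucc
    have hle := hc.2 i rfl
    rcases hle.eq_or_lt with he | hlt
    · simp [he]
    have h2 := h1 fun k hk => by rwa [Fin.castSucc_injective _ hk]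
    have hm := orderedFieldOps_monotone hK hb hle hc
      ⟨fun k hk => (hc.1 k hk).trans hle, fun k hk => by rw [Fin.castSucc_injective _ hk]⟩
    rw [Fin.val_castSucc] at h2 hm
    refine ⟨hle, ?_, ?_⟩
    · rw [mul_assoc, mul_left_comm]
      exact _root_.mul_nonneg (_root_.sub_nonneg.2 hle) h2
    · rw [mul_assoc, mul_left_comm]
      exact _root_.mul_nonneg (_root_.sub_nonneg.2 hle) (h2.trans hm)
  rho_first d a := by
    rw [orderedFieldOps_le]
    obtain ⟨b, y, hb, -⟩ := isVirtualRoots_orderedFieldOps hK a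
    simpa using (orderedFieldOps_rho_succ hK hb 0).2.1 fun k hk => absurd hk (Fin.succ_ne_zero k)
  rho_last d a := by
    rw [orderedFieldOps_le]
    obtain ⟨b, y, hb, -⟩ := isVirtualRoots_orderedFieldOps hK a
    simpa [← two_mul] using (orderedFieldOps_rho_succ hK hb (Fin.last d)).2.2 fun k hk =>
      absurd hk (Fin.castSucc_ne_last k)
  rho_two_eq_sup x y := by
    change _ = max x y
    obtain ⟨b, b', hb, hb', -⟩ := isVirtualRoots_orderedFieldOps hK ![-(x * y), x + y]
    obtain ⟨c, y', hc, -⟩ := isVirtualRoots_orderedFieldOps hK b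
    obtain ⟨-, h3, h4⟩ := orderedFieldOps_rho_succ hK hc 0
    have hb0 : (orderedFieldOps hK).rho 1 0 b = b 0 := by
      have := _root_.le_antisymm (h3 fun k => k.elim0) (h4 fun k => k.elim0)
      simpa [eval_monicPoly, sub_eq_zero] using this
    have hb1 : x + y = 2 * b 0 := by
      have := (derivative_monicPoly_iff _ _).1 hb 0
      norm_num at this
      exact this
    obtain ⟨hcell, h1, h2⟩ := orderedFieldOps_rho_succ hK hb 1
    have h0 := hcell.1 0 rfl
    simp only at h0
    rw [hb0] at h0
    have h2' := h2 fun k hk => absurd hk (Fin.castSucc_ne_last k)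
    have e : ∀ z, (monicPoly ![-(x * y), x + y]).eval z = (z - x) * (z - y) := by
      intro z
      simp [eval_monicPoly, Fin.sum_univ_two]
      ring
    have h1' : b 0 < (orderedFieldOps hK).rho 2 1 ![-(x * y), x + y] →
        (-1) ^ (1 + ((1 : Fin 2) : ℕ)) * (monicPoly ![-(x * y), x + y]).eval
          ((orderedFieldOps hK).rho 2 1 ![-(x * y), x + y]) ≤ 0 := fun hlt => h1 fun k hk => by
      obtain rfl : k = 0 := Subsingleton.elim _ _
      rwa [hb0]
    rw [e] at h2' h1'
    norm_num at h2' h1'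
    generalize (orderedFieldOps hK).rho 2 1 ![-(x * y), x + y] = z at *
    -- The derivative has the midpoint of `x` and `y` as its root. If `z` equals it, (z - x)(z - y)
    -- = -(x - y)²/4 is nonnegative only for `x = y`; if `z` exceeds it, `z` is a genuine root, and
    -- the larger one.
    rcases h0.eq_or_lt with heq | hlt
    · have : x = y := by nlinarith [_root_.sq_nonneg (x - y)]
      subst this
      rw [max_self]
      linarith
    · rcases mul_eq_zero.1 (_root_.le_antisymm (h1' hlt) h2') with h | h
      · rw [max_eq_left (by linarith)]
        linarith
      · rw [max_eq_right (by linarith)]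
        linarith
  fr_mul_abs x y := by
    rw [orderedFieldOps_abs, orderedFieldOps_abs, orderedFieldOps_inf]
    change min |x| |y| ^ 2 / |y| * |y| = _
    rcases eq_or_ne y 0 with rfl | hy
    · simp
    · rw [div_mul_cancel₀ _ (abs_ne_zero.2 hy)]
  fr_nonneg x y := by
    rw [orderedFieldOps_le]
    exact div_nonneg (_root_.sq_nonneg _) (abs_nonneg y)
  fr_le x y := by
    rw [orderedFieldOps_le, orderedFieldOps_abs, orderedFieldOps_abs, orderedFieldOps_inf]
    change min |x| |y| ^ 2 / |y| ≤ _
    have h0 : 0 ≤ min |x| |y| := le_min (abs_nonneg x) (abs_nonneg y)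
    refine div_le_of_le_mul₀ (abs_nonneg y) h0 ?_
    rw [sq]
    exact mul_le_mul_of_nonneg_left (min_le_right _ _) h0

theorem isRealClosedHom_ofOrderedField (hsup : ∀ x y, φ (s.sup x y) = max (φ x) (φ y))
    (hK : ∀ (d : ℕ) (a : Fin d → K), ∃ x, IsVirtualRoots d a x) :
    IsRealClosedHom s (ofOrderedField hK) φ where
  map_sup := hsup
  map_rho _ j a := (orderedFieldOps_rho hK (s.isVirtualRoots_map hsup a) j).symm
  map_fr x y := by
    change φ (s.fr x y) = min |φ x| |φ y| ^ 2 / |φ y|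
    have h1 := congrArg φ (s.fr_mul_abs x y)
    have h2 := s.map_le hsup (s.fr_nonneg x y)
    have h3 := s.map_le hsup (s.fr_le x y)
    rw [map_mul, map_pow, s.map_abs hsup, s.map_inf hsup, s.map_abs hsup, s.map_abs hsup] at h1
    rw [s.map_inf hsup, s.map_abs hsup, s.map_abs hsup] at h3
    rw [map_zero] at h2
    rcases eq_or_ne (φ y) 0 with hy | hy
    · rw [hy] at h3 ⊢
      rw [abs_zero, div_zero]
      exact _root_.le_antisymm (h3.trans (by simp)) h2
    · rw [eq_div_iff (abs_ne_zero.2 hy), h1]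

theorem eq_of_isRealClosedHom_id {t t' : RealClosedStructure A}
    (h : IsRealClosedHom t t' (RingHom.id A)) : t = t' := by
  refine RealClosedStructure.ext ?_ ?_ ?_
  · exact funext₂ fun x y => h.map_sup x y
  · exact funext fun d => funext₂ fun j a => h.map_rho d j a
  · exact funext₂ fun x y => h.map_fr x y

theorem eq_ofOrderedField {t : RealClosedStructure K} (hsup : ∀ x y, t.sup x y = max x y)
    (hK : ∀ (d : ℕ) (a : Fin d → K), ∃ x, IsVirtualRoots d a x) : t = ofOrderedField hK :=
  eq_of_isRealClosedHom_id (isRealClosedHom_ofOrderedField (φ := RingHom.id K) t hsup hK)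

end OrderedField

/-! ### Unique induced structures on fields, and their homogeneity -/

section Field

variable {A : Type u} [CommRing A] {K : Type v} [Field K]

/-- A field of fractions of an image of a real closed ring has a unique induced structure. -/
theorem existsUnique_of_field (s : RealClosedStructure A) {φ : A →+* K} (hφ : IsFractionMap φ) :
    ∃! t : RealClosedStructure K, IsRealClosedHom s t φ := by
  obtain ⟨_, _, hsup⟩ := s.exists_order hφ
  have hK := s.exists_isVirtualRoots hφ hsup
  have h := s.isRealClosedHom_ofOrderedField hsup hK
  exact ⟨ofOrderedField hK, h, fun t ht => eq_ofOrderedField (fun x y => sup_unique hφ ht h x y) hK⟩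

theorem isFractionMap_id {B : Type v} [CommRing B] : IsFractionMap (RingHom.id B) :=
  fun b => ⟨b, 1, by simp, by simp⟩

/-- Every real closed ring structure on a field comes from an ordering. -/
theorem exists_eq_ofOrderedField (t : RealClosedStructure K) : ∃ (_ : LinearOrder K)
    (_ : IsStrictOrderedRing K) (hK : ∀ (d : ℕ) (a : Fin d → K), ∃ x, IsVirtualRoots d a x),
    t = ofOrderedField hK := by
  obtain ⟨i, j, hsup⟩ := t.exists_order isFractionMap_id
  have hK := t.exists_isVirtualRoots isFractionMap_id hsup
  exact ⟨i, j, hK, eq_ofOrderedField hsup hK⟩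

/-- With `sq_mul_fr` and `sq_mul_sup`, this homogeneity lets every operation be computed after
clearing denominators. -/
theorem sq_mul_rho (t : RealClosedStructure K) (w : K) {d : ℕ} (j : Fin d) (a : Fin d → K) :
    w ^ 2 * t.rho d j a = t.rho d j (scaleCoeff (w ^ 2) a) := by
  obtain ⟨_, _, hK, rfl⟩ := t.exists_eq_ofOrderedField
  exact (orderedFieldOps_rho hK ((isVirtualRoots_orderedFieldOps hK a).scale
    (_root_.sq_nonneg w)) j).symm

theorem sq_mul_fr (t : RealClosedStructure K) (w x y : K) :
    w ^ 2 * t.fr x y = t.fr (w ^ 2 * x) (w ^ 2 * y) := by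
  obtain ⟨_, _, hK, rfl⟩ := t.exists_eq_ofOrderedField
  change w ^ 2 * (min |x| |y| ^ 2 / |y|) = min |w ^ 2 * x| |w ^ 2 * y| ^ 2 / |w ^ 2 * y|
  have hw := _root_.sq_nonneg w
  rw [abs_mul, abs_mul, _root_.abs_of_nonneg hw, ← mul_min_of_nonneg _ _ hw]
  rcases eq_or_ne w 0 with rfl | hw0
  · simp
  · rw [mul_pow]
    field_simp

end Field

end RealClosedStructure

/-! ### Transfer of structures along embeddings into products -/

namespace RealClosedStructure

section Embedding

variable {B : Type u} [CommRing B] {ι : Type w} {K : ι → Type v} [∀ i, CommRing (K i)]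

theorem eq_of_injective {s s' : RealClosedStructure B} (t : ∀ i, RealClosedStructure (K i))
    (ψ : ∀ i, B →+* K i) (hinj : ∀ x y, (∀ i, ψ i x = ψ i y) → x = y)
    (h : ∀ i, IsRealClosedHom s (t i) (ψ i)) (h' : ∀ i, IsRealClosedHom s' (t i) (ψ i)) :
    s = s' := by
  refine RealClosedStructure.ext ?_ ?_ ?_
  · exact funext₂ fun x y => hinj _ _ fun i => by rw [(h i).map_sup, (h' i).map_sup]
  · exact funext fun d => funext₂ fun j a => hinj _ _ fun i => by rw [(h i).map_rho, (h' i).map_rho]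
  · exact funext₂ fun x y => hinj _ _ fun i => by rw [(h i).map_fr, (h' i).map_fr]

/-- A ring that embeds into a product of real closed rings and is closed under the operations is
a real closed ring. -/
theorem exists_of_injective (t : ∀ i, RealClosedStructure (K i))
    (ψ : ∀ i, B →+* K i) (hinj : ∀ x y, (∀ i, ψ i x = ψ i y) → x = y)
    (hsup : ∀ x y, ∃ z, ∀ i, ψ i z = (t i).sup (ψ i x) (ψ i y))
    (hrho : ∀ (d : ℕ) (j : Fin d) (a : Fin d → B),
      ∃ z, ∀ i, ψ i z = (t i).rho d j fun k => ψ i (a k))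
    (hfr : ∀ x y, ∃ z, ∀ i, ψ i z = (t i).fr (ψ i x) (ψ i y)) :
    ∃ s : RealClosedStructure B, ∀ i, IsRealClosedHom s (t i) (ψ i) := by
  choose sup hsup using hsup
  choose rho hrho using hrho
  choose fr hfr using hfr
  let o : RealClosedOps B := ⟨sup, rho, fr⟩
  have osup : ∀ i x y, ψ i (o.sup x y) = (t i).sup (ψ i x) (ψ i y) := fun i x y => hsup x y i
  have orho : ∀ i d j a, ψ i (o.rho d j a) = (t i).rho d j fun k => ψ i (a k) :=
    fun i d j a => hrho d j a i
  have ofr : ∀ i x y, ψ i (o.fr x y) = (t i).fr (ψ i x) (ψ i y) := fun i x y => hfr x y i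
  have opos : ∀ i x, ψ i (o.pos x) = (t i).pos (ψ i x) := fun i x => by
    rw [RealClosedOps.pos, osup, map_zero]; rfl
  have oabs : ∀ i x, ψ i (o.abs x) = (t i).abs (ψ i x) := fun i x => by
    rw [RealClosedOps.abs, osup, map_neg]; rfl
  have oinf : ∀ i x y, ψ i (o.inf x y) = (t i).inf (ψ i x) (ψ i y) := fun i x y => by
    rw [RealClosedOps.inf, map_neg, osup, map_neg, map_neg]; rfl
  have ole : ∀ x y, (∀ i, (t i).le (ψ i x) (ψ i y)) → o.le x y := fun x y h =>
    hinj _ _ fun i => by rw [osup]; exact h i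
  refine ⟨⟨o, ?_, ?_, ?_, ?_, ?_, ?_, ?_, ?_, ?_, ?_, ?_, ?_, ?_, ?_⟩,
    fun i => ⟨osup i, orho i, ofr i⟩⟩
  · exact fun x => hinj _ _ fun i => by rw [osup, (t i).sup_self]
  · exact fun x y => hinj _ _ fun i => by rw [osup, osup, (t i).sup_comm]
  · exact fun x y z => hinj _ _ fun i => by simp only [osup, (t i).sup_assoc]
  · exact fun x y z => hinj _ _ fun i => by simp only [osup, map_add, (t i).add_sup]
  · exact fun x y z => hinj _ _ fun i => by simp only [osup, opos, map_mul, (t i).pos_mul_sup]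
  · exact fun a => hinj _ _ fun i => by rw [orho, (t i).rho_one]
  · intro d a b hb k
    -- The premise on the derivative survives every ring morphism, so even this conditional axiom
    -- can be checked in each factor.
    have h := fun i => (t i).rho_lower d _ _ (map_derivative_monicPoly (ψ i) hb) k
    refine ⟨ole _ _ fun i => ?_, ole _ _ fun i => ?_, ole _ _ fun i => ?_⟩
    · simpa only [orho] using (h i).1
    · simpa [orho, map_eval_monicPoly] using (h i).2.1
    · simpa [orho, map_eval_monicPoly] using (h i).2.2
  · intro d a b hb k
    have h := fun i => (t i).rho_upper d _ _ (map_derivative_monicPoly (ψ i) hb) k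
    refine ⟨ole _ _ fun i => ?_, ole _ _ fun i => ?_, ole _ _ fun i => ?_⟩
    · simpa only [orho] using (h i).1
    · simpa [orho, map_eval_monicPoly] using (h i).2.1
    · simpa [orho, map_eval_monicPoly] using (h i).2.2
  · refine fun d a => ole _ _ fun i => ?_
    simpa [orho, map_eval_monicPoly] using (t i).rho_first d fun k => ψ i (a k)
  · refine fun d a => ole _ _ fun i => ?_
    simpa [orho, map_eval_monicPoly] using (t i).rho_last d fun k => ψ i (a k)
  · refine fun x y => hinj _ _ fun i => ?_
    rw [osup, orho, ← (t i).rho_two_eq_sup]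
    congr 1
    ext k
    fin_cases k <;> simp
  · exact fun x y => hinj _ _ fun i => by
      simp only [map_mul, map_pow, ofr, oabs, oinf, (t i).fr_mul_abs]
  · exact fun x y => ole _ _ fun i => by
      rw [map_zero, ofr]; exact (t i).fr_nonneg _ _
  · exact fun x y => ole _ _ fun i => by
      rw [ofr, oinf, oabs, oabs]; exact (t i).fr_le _ _

end Embedding

theorem _root_.IsRealClosedHom.comp {A : Type u} {B : Type v} {C : Type w} [CommRing A]
    [CommRing B] [CommRing C] {s : RealClosedStructure A} {t : RealClosedStructure B}
    {r : RealClosedStructure C} {g : B →+* C} {f : A →+* B} (hg : IsRealClosedHom t r g)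
    (hf : IsRealClosedHom s t f) : IsRealClosedHom s r (g.comp f) where
  map_sup x y := by simp [hf.map_sup, hg.map_sup]
  map_rho d j a := by simp [hf.map_rho, hg.map_rho]
  map_fr x y := by simp [hf.map_fr, hg.map_fr]

/-! ### Quotients and localisations -/

section Fraction

variable {A : Type u} [CommRing A] {B : Type v} [CommRing B]

theorem IsFractionMap.of_comp {C : Type w} [CommRing C] {g : B →+* C} {f : A →+* B}
    (h : IsFractionMap (g.comp f)) : IsFractionMap g := fun c => by
  obtain ⟨a, v, hv, e⟩ := h c
  exact ⟨f a, f v, hv, e⟩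

theorem IsFractionMap.comp_residueField {f : A →+* B} (hf : IsFractionMap f) (Q : Ideal B)
    [Q.IsPrime] :
    IsFractionMap (((algebraMap (B ⧸ Q) (FractionRing (B ⧸ Q))).comp (Ideal.Quotient.mk Q)).comp
      f) := by
  intro k
  set ψ := (algebraMap (B ⧸ Q) (FractionRing (B ⧸ Q))).comp (Ideal.Quotient.mk Q)
  obtain ⟨x, y, hy, rfl⟩ := IsFractionRing.div_surjective (A := B ⧸ Q) k
  obtain ⟨x, rfl⟩ := Ideal.Quotient.mk_surjective x
  obtain ⟨y, rfl⟩ := Ideal.Quotient.mk_surjective y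
  have hy0 : ψ y ≠ 0 :=
    IsFractionRing.to_map_ne_zero_of_mem_nonZeroDivisors (R := B ⧸ Q)
      (x := Ideal.Quotient.mk Q y) hy
  obtain ⟨a, b, v, hv, ha, hb⟩ := hf.exists_pair x y
  have hv0 : ψ (f v) ≠ 0 := (hv.map ψ).ne_zero
  -- With the common denominator v² for `x` and `y`, the fraction x/y becomes a/b.
  refine ⟨a, b, IsUnit.mk0 _ ?_, ?_⟩
  · rw [RingHom.comp_apply, ← hb, map_mul, map_pow]
    exact mul_ne_zero (pow_ne_zero _ hv0) hy0
  · change ψ (f b) * (ψ x / ψ y) = ψ (f a)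
    rw [← hb, ← ha, map_mul, map_mul]
    field_simp

theorem eq_of_forall_residueField [IsReduced B] {x y : B} (h : ∀ Q : PrimeSpectrum B,
    (algebraMap (B ⧸ Q.asIdeal) (FractionRing (B ⧸ Q.asIdeal))).comp
      (Ideal.Quotient.mk Q.asIdeal) x =
    (algebraMap (B ⧸ Q.asIdeal) (FractionRing (B ⧸ Q.asIdeal))).comp
      (Ideal.Quotient.mk Q.asIdeal) y) : x = y := by
  rw [← sub_eq_zero]
  refine IsNilpotent.eq_zero (nilpotent_iff_mem_prime.2 fun J hJ => ?_)
  have := IsFractionRing.injective (B ⧸ J) (FractionRing (B ⧸ J)) (h ⟨J, hJ⟩)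
  exact Ideal.Quotient.eq.1 this

/-- Induced structures on quotients by radical ideals and on localisations. -/
theorem existsUnique_of_isFractionMap [IsReduced B] (s : RealClosedStructure A) {f : A →+* B}
    (hf : IsFractionMap f) : ∃! t : RealClosedStructure B, IsRealClosedHom s t f := by
  let ψ (Q : PrimeSpectrum B) : B →+* FractionRing (B ⧸ Q.asIdeal) :=
    (algebraMap (B ⧸ Q.asIdeal) (FractionRing (B ⧸ Q.asIdeal))).comp
      (Ideal.Quotient.mk Q.asIdeal)
  have hinj : ∀ x y, (∀ Q, ψ Q x = ψ Q y) → x = y := fun x y h => eq_of_forall_residueField h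
  have hφ (Q : PrimeSpectrum B) : IsFractionMap ((ψ Q).comp f) :=
    hf.comp_residueField Q.asIdeal
  choose τ hτ hτu using fun Q => s.existsUnique_of_field (hφ Q)
  have hdiv (v : A) (hv : IsUnit (f v)) (c : A) : ∃ z, f v ^ 2 * z = f c := by
    obtain ⟨z, hz⟩ := (hv.pow 2).dvd (a := f c)
    exact ⟨z, hz.symm⟩
  have hcancel (Q : PrimeSpectrum B) (v : A) (hv : IsUnit (f v))
      {z z' : FractionRing (B ⧸ Q.asIdeal)}
      (h : ψ Q (f v) ^ 2 * z = ψ Q (f v) ^ 2 * z') : z = z' :=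
    ((hv.map (ψ Q)).pow 2).mul_left_cancel h
  -- For each operation the element of `B` is found by applying `s` to numerators in `A` and
  -- dividing by f(v)²; it does not depend on `Q`.
  obtain ⟨t, ht⟩ := exists_of_injective τ ψ hinj
    (fun x y => by
      obtain ⟨a, b, v, hv, ha, hb⟩ := hf.exists_pair x y
      obtain ⟨z, hz⟩ := hdiv v hv (s.sup a b)
      refine ⟨z, fun Q => hcancel Q v hv ?_⟩
      rw [sq_mul_sup, ← map_pow, ← map_mul, ← map_mul, ← map_mul, ha, hb, hz]
      exact (hτ Q).map_sup a b)
    (fun d j b => by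
      obtain ⟨a, v, hv, ha⟩ := hf.exists_scaleCoeff b
      obtain ⟨z, hz⟩ := hdiv v hv (s.rho d j a)
      refine ⟨z, fun Q => hcancel Q v hv ?_⟩
      have e : scaleCoeff (ψ Q (f v) ^ 2) (fun k => ψ Q (b k)) = fun k => ψ Q (f (a k)) := by
        ext k
        rw [← congrFun ha k]
        simp [scaleCoeff]
      rw [sq_mul_rho, e, ← map_pow, ← map_mul, hz]
      exact (hτ Q).map_rho d j a)
    (fun x y => by
      obtain ⟨a, b, v, hv, ha, hb⟩ := hf.exists_pair x y
      obtain ⟨z, hz⟩ := hdiv v hv (s.fr a b)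
      refine ⟨z, fun Q => hcancel Q v hv ?_⟩
      rw [sq_mul_fr, ← map_pow, ← map_mul, ← map_mul, ← map_mul, ha, hb, hz]
      exact (hτ Q).map_fr a b)
  refine ⟨t, ⟨fun x y => ?_, fun d j a => ?_, fun x y => ?_⟩, fun t' ht' => ?_⟩
  · exact hinj _ _ fun Q => ((hτ Q).map_sup x y).trans ((ht Q).map_sup _ _).symm
  · exact hinj _ _ fun Q => ((hτ Q).map_rho d j a).trans ((ht Q).map_rho _ _ _).symm
  · exact hinj _ _ fun Q => ((hτ Q).map_fr x y).trans ((ht Q).map_fr _ _).symm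
  -- Any other induced structure on `B` induces one on each residue field; composed with `f` it is
  -- induced from `s`, hence equal to `τ Q`.
  · refine eq_of_injective τ ψ hinj (fun Q => ?_) ht
    obtain ⟨τ', h', -⟩ := t'.existsUnique_of_field (hφ Q).of_comp
    rwa [hτu Q τ' (h'.comp ht')] at h'

theorem existsUnique_quotient (s : RealClosedStructure A) {I : Ideal A} (hI : I.IsRadical) :
    ∃! t : RealClosedStructure (A ⧸ I), IsRealClosedHom s t (Ideal.Quotient.mk I) := by
  have : IsReduced (A ⧸ I) := (Ideal.isRadical_iff_quotient_reduced I).1 hI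
  refine s.existsUnique_of_isFractionMap fun b => ?_
  obtain ⟨a, rfl⟩ := Ideal.Quotient.mk_surjective b
  exact ⟨a, 1, by simp, by simp⟩

theorem isFractionMap_localization (S : Submonoid A) :
    IsFractionMap (algebraMap A (Localization S)) := fun b => by
  obtain ⟨⟨a, v⟩, h⟩ := IsLocalization.surj S b
  exact ⟨a, v, IsLocalization.map_units _ v, by rw [mul_comm]; exact h⟩

theorem existsUnique_localization (s : RealClosedStructure A) (S : Submonoid A) :
    ∃! t : RealClosedStructure (Localization S),
      IsRealClosedHom s t (algebraMap A (Localization S)) := by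
  have := s.isReduced
  exact s.existsUnique_of_isFractionMap (isFractionMap_localization S)

end Fraction

end RealClosedStructure

/-! ### Gluing along comaximal monoids -/

section Gluing

variable {A : Type u} [CommRing A]

theorem localizationMap_comp_algebraMap {S T : Submonoid A} (h : S ≤ T) :
    (localizationMap h).comp (algebraMap A (Localization S)) = algebraMap A (Localization T) := by
  ext a
  exact IsLocalization.map_eq h a

theorem localizationMap_algebraMap {S T : Submonoid A} (h : S ≤ T) (a : A) :
    localizationMap h (algebraMap A (Localization S) a) = algebraMap A (Localization T) a :=
  congrArg (fun g => g a) (localizationMap_comp_algebraMap h)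

theorem isFractionMap_localizationMap {S T : Submonoid A} (h : S ≤ T) :
    RealClosedStructure.IsFractionMap (localizationMap h) :=
  RealClosedStructure.IsFractionMap.of_comp (f := algebraMap A (Localization S)) (by
    rw [localizationMap_comp_algebraMap]
    exact RealClosedStructure.isFractionMap_localization T)

variable {n : ℕ} {S : Fin n → Submonoid A}

theorem Comaximal.eq_of_forall_localization (hS : Comaximal S) {a b : A}
    (h : ∀ i, algebraMap A (Localization (S i)) a = algebraMap A (Localization (S i)) b) :
    a = b := by
  have h' := fun i => (IsLocalization.eq_iff_exists (S i) (Localization (S i))).1 (h i)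
  choose s hs using h'
  have h1 : (1 : A) ∈ Ideal.span (Set.range fun i => (s i : A)) := by
    rw [hS (fun i => s i) fun i => (s i).2]
    trivial
  obtain ⟨c, hc⟩ := Ideal.mem_span_range_iff_exists_fun.1 h1
  calc a = (∑ i, c i * s i) * a := by rw [hc, one_mul]
    _ = (∑ i, c i * s i) * b := by
      rw [Finset.sum_mul, Finset.sum_mul]
      exact Finset.sum_congr rfl fun i _ => by rw [mul_assoc, hs, mul_assoc]
    _ = b := by rw [hc, one_mul]

/-- Compatible elements of the localisations at comaximal monoids come from a global element. -/
theorem Comaximal.exists_glue (hS : Comaximal S) (b : ∀ i, Localization (S i))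
    (hb : ∀ i j, i < j → localizationMap (le_sup_left : S i ≤ S i ⊔ S j) (b i) =
      localizationMap (le_sup_right : S j ≤ S i ⊔ S j) (b j)) :
    ∃ a : A, ∀ i, algebraMap A (Localization (S i)) a = b i := by
  choose cs hcs using fun i => IsLocalization.surj (S i) (b i)
  have hlt : ∀ i j, i < j → ∃ p ∈ S i, ∃ q ∈ S j,
      p * q * ((cs i).1 * (cs j).2) = p * q * ((cs j).1 * (cs i).2) := by
    intro i j hij
    have hi := congrArg (localizationMap (le_sup_left : S i ≤ S i ⊔ S j)) (hcs i)
    have hj := congrArg (localizationMap (le_sup_right : S j ≤ S i ⊔ S j)) (hcs j)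
    rw [map_mul, localizationMap_algebraMap, localizationMap_algebraMap] at hi hj
    have : algebraMap A (Localization (S i ⊔ S j)) ((cs i).1 * (cs j).2) =
        algebraMap A (Localization (S i ⊔ S j)) ((cs j).1 * (cs i).2) := by
      rw [map_mul, map_mul, ← hi, ← hj, hb i j hij]
      ring
    obtain ⟨t, ht⟩ := (IsLocalization.eq_iff_exists (S i ⊔ S j) _).1 this
    obtain ⟨p, hp, q, hq, hpq⟩ := Submonoid.mem_sup.1 t.2
    exact ⟨p, hp, q, hq, by rw [hpq]; exact ht⟩
  have hall : ∀ i j, ∃ p ∈ S i, ∃ q ∈ S j,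
      p * q * ((cs i).1 * (cs j).2) = p * q * ((cs j).1 * (cs i).2) := by
    intro i j
    rcases lt_trichotomy i j with h | rfl | h
    · exact hlt i j h
    · exact ⟨1, one_mem _, 1, one_mem _, rfl⟩
    · obtain ⟨p, hp, q, hq, e⟩ := hlt j i h
      exact ⟨q, hq, p, hp, by rw [mul_comm q p, e]⟩
  choose p hp q hq hpq using hall
  -- `m i` collects all the elements of `S i` that occur in the pairwise relations, in either
  -- position, so `m i * m j` validates the relation for every pair.
  let m (i : Fin n) : A := ∏ j, p i j * q j i
  have hm (i : Fin n) : m i ∈ S i := prod_mem fun j _ => mul_mem (hp i j) (hq j i)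
  have hm' (i j : Fin n) : m i * m j * ((cs i).1 * (cs j).2) =
      m i * m j * ((cs j).1 * (cs i).2) := by
    obtain ⟨x, hx⟩ := (Dvd.intro _ rfl : p i j ∣ p i j * q j i).trans
      (Finset.dvd_prod_of_mem (fun j => p i j * q j i) (Finset.mem_univ j))
    obtain ⟨y, hy⟩ := (Dvd.intro_left _ rfl : q i j ∣ p j i * q i j).trans
      (Finset.dvd_prod_of_mem (fun i => p j i * q i j) (Finset.mem_univ i))
    change m i = _ at hx
    change m j = _ at hy
    rw [hx, hy]
    linear_combination x * y * hpq i j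
  have h1 : (1 : A) ∈ Ideal.span (Set.range fun i => m i * (cs i).2) := by
    rw [hS (fun i => m i * (cs i).2) fun i => mul_mem (hm i) (cs i).2.2]
    trivial
  obtain ⟨u, hu⟩ := Ideal.mem_span_range_iff_exists_fun.1 h1
  -- The numerators are weighted by the partition of unity Σ u_i m_i s_i = 1, where s_i is the
  -- denominator of `b i`.
  refine ⟨∑ i, u i * (m i * (cs i).1), fun j => ?_⟩
  have key : (∑ i, u i * (m i * (cs i).1)) * (m j * (cs j).2) = m j * (cs j).1 := by
    calc _ = ∑ i, u i * (m i * (cs i).2) * (m j * (cs j).1) := by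
          rw [Finset.sum_mul]
          exact Finset.sum_congr rfl fun i _ => by linear_combination u i * hm' i j
      _ = _ := by rw [← Finset.sum_mul, hu, one_mul]
  refine (IsLocalization.map_units (Localization (S j))
    (⟨m j * (cs j).2, mul_mem (hm j) (cs j).2.2⟩ : S j)).mul_right_cancel ?_
  rw [← map_mul]
  change algebraMap A _ ((∑ i, u i * (m i * (cs i).1)) * (m j * (cs j).2)) =
    b j * algebraMap A _ (m j * (cs j).2)
  rw [key, map_mul, map_mul, ← hcs j]
  ring

/-- Compatible ring morphisms to the localisations at comaximal monoids come from a global one. -/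
theorem Comaximal.exists_glue_ringHom (hS : Comaximal S) {B : Type v} [CommRing B]
    (g : ∀ i, B →+* Localization (S i))
    (hg : ∀ i j, i < j →
      (localizationMap (le_sup_left : S i ≤ S i ⊔ S j)).comp (g i) =
        (localizationMap (le_sup_right : S j ≤ S i ⊔ S j)).comp (g j)) :
    ∃ h : B →+* A, ∀ i, (algebraMap A (Localization (S i))).comp h = g i := by
  choose h hh using fun x => hS.exists_glue (fun i => g i x)
    fun i j hij => congrArg (fun k => k x) (hg i j hij)
  refine ⟨{ toFun := h, map_one' := ?_, map_mul' := ?_, map_zero' := ?_, map_add' := ?_ },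
    fun i => RingHom.ext fun x => hh x i⟩
  · exact hS.eq_of_forall_localization fun i => by rw [hh, map_one, map_one]
  · exact fun x y => hS.eq_of_forall_localization fun i => by simp only [hh, map_mul]
  · exact hS.eq_of_forall_localization fun i => by rw [hh, map_zero, map_zero]
  · exact fun x y => hS.eq_of_forall_localization fun i => by simp only [hh, map_add]

theorem Comaximal.isReduced (hS : Comaximal S) (σ : ∀ i, RealClosedStructure (Localization (S i))) :
    IsReduced A := by
  refine (isReduced_iff_pow_one_lt 2 one_lt_two).2 fun x hx => ?_
  refine hS.eq_of_forall_localization fun i => ?_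
  rw [map_zero]
  exact (σ i).eq_zero_of_sq_eq_zero (by rw [← map_pow, hx, map_zero])

/-- The hypothesis only compares induced structures; that they exist follows from the localisation
result, since `A` and hence the overlap are reduced. -/
theorem Comaximal.existsUnique_overlap (hS : Comaximal S)
    (σ : ∀ i, RealClosedStructure (Localization (S i)))
    (hσ : ∀ i j, i < j → ∀ t t' : RealClosedStructure (Localization (S i ⊔ S j)),
      IsRealClosedHom (σ i) t (localizationMap le_sup_left) →
      IsRealClosedHom (σ j) t' (localizationMap le_sup_right) → t = t') (i j : Fin n) (hij : i < j) :
    ∃! t : RealClosedStructure (Localization (S i ⊔ S j)),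
      IsRealClosedHom (σ i) t (localizationMap le_sup_left) ∧
      IsRealClosedHom (σ j) t (localizationMap le_sup_right) := by
  have := hS.isReduced σ
  obtain ⟨t, ht, -⟩ := (σ i).existsUnique_of_isFractionMap
    (isFractionMap_localizationMap (le_sup_left : S i ≤ S i ⊔ S j))
  obtain ⟨t', ht', -⟩ := (σ j).existsUnique_of_isFractionMap
    (isFractionMap_localizationMap (le_sup_right : S j ≤ S i ⊔ S j))
  have := hσ i j hij t t' ht ht'
  subst this
  exact ⟨t, ⟨ht, ht'⟩, fun r hr => hσ i j hij r t hr.1 ht'⟩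

theorem Comaximal.exists_realClosedStructure (hS : Comaximal S)
    (σ : ∀ i, RealClosedStructure (Localization (S i)))
    (hσ : ∀ i j, i < j → ∃! t : RealClosedStructure (Localization (S i ⊔ S j)),
      IsRealClosedHom (σ i) t (localizationMap le_sup_left) ∧
      IsRealClosedHom (σ j) t (localizationMap le_sup_right)) :
    ∃ s : RealClosedStructure A,
      ∀ i, IsRealClosedHom s (σ i) (algebraMap A (Localization (S i))) := by
  refine RealClosedStructure.exists_of_injective σ _
    (fun x y h => hS.eq_of_forall_localization h) (fun x y => ?_) (fun d k a => ?_) fun x y => ?_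
  all_goals
    refine hS.exists_glue _ fun i j hij => ?_
    obtain ⟨t, ⟨h1, h2⟩, -⟩ := hσ i j hij
  · simp only [h1.map_sup, h2.map_sup, localizationMap_algebraMap]
  · simp only [h1.map_rho, h2.map_rho, localizationMap_algebraMap]
  · simp only [h1.map_fr, h2.map_fr, localizationMap_algebraMap]

end Gluing

theorem mainTheorem11 {A : Type u} [CommRing A] :
    -- quotients by radical ideals
    (∀ (s : RealClosedStructure A) (I : Ideal A), I.IsRadical →
      ∃! t : RealClosedStructure (A ⧸ I), IsRealClosedHom s t (Ideal.Quotient.mk I)) ∧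
    -- localisations
    (∀ (s : RealClosedStructure A) (S : Submonoid A),
      ∃! t : RealClosedStructure (Localization S),
        IsRealClosedHom s t (algebraMap A (Localization S))) ∧
    -- gluing; the monoid `S i * S j` is the supremum `S i ⊔ S j`
    (∀ (n : ℕ) (S : Fin n → Submonoid A), Comaximal S →
      ∀ σ : ∀ i, RealClosedStructure (Localization (S i)),
      -- the structures induced on `A_ij` by those of `A_i` and `A_j` coincide
      (∀ i j, i < j → ∀ t t' : RealClosedStructure (Localization (S i ⊔ S j)),
        IsRealClosedHom (σ i) t (localizationMap le_sup_left) →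
        IsRealClosedHom (σ j) t' (localizationMap le_sup_right) → t = t') →
      -- existence and uniqueness of the structure on `A`
      ∃ s : RealClosedStructure A,
        (∀ i, IsRealClosedHom s (σ i) (algebraMap A (Localization (S i)))) ∧
        (∀ s' : RealClosedStructure A,
          (∀ i, IsRealClosedHom s' (σ i) (algebraMap A (Localization (S i)))) → s' = s) ∧
        -- the diagram of the `A_i` and `A_ij` lies in the category of real closed rings
        (∀ i j, i < j → ∃! t : RealClosedStructure (Localization (S i ⊔ S j)),
          IsRealClosedHom (σ i) t (localizationMap le_sup_left) ∧
          IsRealClosedHom (σ j) t (localizationMap le_sup_right)) ∧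
        -- `(A, s)` with the localisation morphisms is a cone on this diagram, and a limit cone
        (∀ i j, i < j →
          (localizationMap (le_sup_left : S i ≤ S i ⊔ S j)).comp
              (algebraMap A (Localization (S i))) =
            (localizationMap (le_sup_right : S j ≤ S i ⊔ S j)).comp
              (algebraMap A (Localization (S j)))) ∧
        ∀ (B : Type v) [CommRing B] (r : RealClosedStructure B)
          (g : ∀ i, B →+* Localization (S i)),
          (∀ i, IsRealClosedHom r (σ i) (g i)) →
          (∀ i j, i < j →
            (localizationMap (le_sup_left : S i ≤ S i ⊔ S j)).comp (g i) =
              (localizationMap (le_sup_right : S j ≤ S i ⊔ S j)).comp (g j)) →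
          ∃! h : B →+* A, IsRealClosedHom r s h ∧
            ∀ i, (algebraMap A (Localization (S i))).comp h = g i) := by
  refine ⟨fun s I hI => s.existsUnique_quotient hI, fun s S => s.existsUnique_localization S,
    fun n S hS σ hσ => ?_⟩
  have hσ' := hS.existsUnique_overlap σ hσ
  obtain ⟨s, hs⟩ := hS.exists_realClosedStructure σ hσ'
  have hinj : ∀ {x y : A}, (∀ i, algebraMap A (Localization (S i)) x =
      algebraMap A (Localization (S i)) y) → x = y := hS.eq_of_forall_localization
  refine ⟨s, hs, fun s' hs' => RealClosedStructure.eq_of_injective σ _ (fun _ _ => hinj) hs' hs,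
    hσ', fun i j _ => ?_, fun B _ r g hg hcomp => ?_⟩
  · rw [localizationMap_comp_algebraMap, localizationMap_comp_algebraMap]
  · obtain ⟨h, hh⟩ := hS.exists_glue_ringHom g hcomp
    have hh' : ∀ i x, algebraMap A (Localization (S i)) (h x) = g i x := fun i x =>
      congrArg (fun k => k x) (hh i)
    refine ⟨h, ⟨⟨fun x y => ?_, fun d j a => ?_, fun x y => ?_⟩, hh⟩, fun h' H => ?_⟩
    -- The glued ring morphism respects the operations because this can be tested in each
    -- localisation.
    · exact hinj fun i => by rw [hh', (hg i).map_sup, (hs i).map_sup, hh', hh']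
    · exact hinj fun i => by simp only [hh', (hg i).map_rho, (hs i).map_rho]
    · exact hinj fun i => by rw [hh', (hg i).map_fr, (hs i).map_fr, hh', hh']
    · refine RingHom.ext fun x => hinj fun i => ?_
      rw [hh', ← H.2 i, RingHom.comp_apply]
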